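/- Graphs may have parallel edges but no loops, need not be connected, and may be infinite; $d_G(v)$ is the number of edges of $G$ incident with the vertex $v$, and $G$ is locally finite if every vertex has finite degree. A ray is a one-way infinite path. An end of $G$ is an equivalence class of rays, where two rays are equivalent if for every finite $S\subseteq V(G)$ they have tails in the same component of $G-S$. Let $\hat V(G)$ be the union of the vertex set $V(G)$ and the set of all ends of $G$. For an end $\omega$ and $S\subseteq V(G)$, an $S$–$\omega$ ray is a ray in $\omega$ that meets $S$ exactly in its first vertex. An end $\omega$ of a locally finite graph is *even* (has even degree) if there is a finite set $S\subseteq V(G)$ such that for every finite $S'\subseteq V(G)$ with $S'\supseteq S$ the maximum number of pairwise edge-disjoint $S'$–$\omega$ rays is even. A locally finite graph $G$ is *inner-Eulerian* for $T\subseteq\hat V(G)$ if every vertex and every end in $\hat V(G)\setminus T$ has even degree in $G$. A *cut* with sides $A$ and $B$, where $\{A,B\}$ is a bipartition of $V(G)$, is the set of all edges of $G$ between $A$ and $B$. A set $T\subseteq\hat V(G)$ *lives in* $C\subseteq V(G)$ if all vertices in $T$ lie in $C$ and all rays of ends in $T$ have tails in $G[C]$. **Lemma A.3.** Let $G$ be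 a locally finite graph which is inner-Eulerian for $T\subseteq\hat V(G)$. Then every finite cut of $G$ such that $T$ lives in one of its sides has an even number of edges. -/

import Mathlib

open scoped Graph

namespace Graph

variable {α β : Type*}

/-- The degree of a vertex: the number of edges incident with it, possibly infinite.
(It is only used for loopless graphs.) -/
noncomputable def vertexDegree (G : Graph α β) (x : α) : ℕ∞ := (G.incidenceSet x).encard

/-- All vertices have finite degree. -/
def IsLocallyFinite (G : Graph α β) : Prop := ∀ x ∈ V(G), G.vertexDegree x < ⊤

/-- A vertex is even if its degree is an even natural number. -/
def IsEvenVertex (G : Graph α β) (x : α) : Prop := ∃ n : ℕ, G.vertexDegree x = n ∧ Even n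

/-- `x` and `y` are vertices of the same component of `G`. -/
def SameComponent (G : Graph α β) (x y : α) : Prop :=
  x ∈ V(G) ∧ Relation.ReflTransGen G.Adj x y

/-- A ray: a one-way infinite path `v₀ e₀ v₁ e₁ v₂ …` with pairwise distinct vertices.
(A ray has a unique first vertex, so it is the same thing as this sequence.) -/
structure Ray (G : Graph α β) where
  vertex : ℕ → α
  edge : ℕ → β
  isLink : ∀ n, G.IsLink (edge n) (vertex n) (vertex (n + 1))
  injective : Function.Injective vertex

/-- The set of edges of a ray. -/
def Ray.edges {G : Graph α β} (R : G.Ray) : Set β := Set.range R.edge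

/-- The ray `R` has a tail in (the subgraph induced by) the vertex set `C`. -/
def Ray.HasTailIn {G : Graph α β} (R : G.Ray) (C : Set α) : Prop :=
  ∃ N, ∀ n, N ≤ n → R.vertex n ∈ C

/-- Two rays are equivalent if, for every finite vertex set `S`, they have tails in the same
component of `G - S`. -/
def Ray.Equivalent {G : Graph α β} (R R' : G.Ray) : Prop :=
  ∀ S : Set α, S.Finite → S ⊆ V(G) →
    ∃ N, ∀ m n, N ≤ m → N ≤ n →
      (G.deleteVerts S).SameComponent (R.vertex m) (R'.vertex n)

lemma SameComponent.symm {G : Graph α β} {x y : α} (h : G.SameComponent x y) :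
    G.SameComponent y x := by
  obtain ⟨hx, h⟩ := h
  have hsymm : Relation.ReflTransGen G.Adj y x := by
    induction h with
    | refl => exact .refl
    | tail _ hbc ih => exact .head hbc.symm ih
  refine ⟨?_, hsymm⟩
  rcases h.cases_tail with rfl | ⟨c, _, hc⟩
  · exact hx
  · exact hc.right_mem

lemma SameComponent.trans {G : Graph α β} {x y z : α} (h : G.SameComponent x y)
    (h' : G.SameComponent y z) : G.SameComponent x z :=
  ⟨h.1, h.2.trans h'.2⟩

lemma Ray.equivalent_refl {G : Graph α β} (R : G.Ray) : R.Equivalent R := by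
  intro S hS _
  have hfin : (R.vertex ⁻¹' S).Finite := hS.preimage R.injective.injOn
  obtain ⟨M, hM⟩ := hfin.bddAbove
  have hout : ∀ n, M + 1 ≤ n → R.vertex n ∉ S := by
    intro n hn hmem
    have : n ≤ M := hM hmem
    omega
  have key : ∀ m, M + 1 ≤ m → ∀ k,
      (G.deleteVerts S).SameComponent (R.vertex m) (R.vertex (m + k)) := by
    intro m hm k
    refine ⟨by simpa using ⟨(R.isLink m).left_mem, hout m hm⟩, ?_⟩
    induction k with
    | zero => exact .refl
    | succ k ih =>
      refine ih.tail ⟨R.edge (m + k), ?_⟩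
      have h1 := hout (m + k) (by omega)
      have h2 := hout (m + k + 1) (by omega)
      have h3 := R.isLink (m + k)
      simp only [Graph.deleteVerts_isLink]
      exact ⟨h3, h1, h2⟩
  refine ⟨M + 1, fun m n hm hn ↦ ?_⟩
  rcases le_total m n with h | h
  · obtain ⟨k, rfl⟩ := Nat.exists_eq_add_of_le h
    exact key m hm k
  · obtain ⟨k, rfl⟩ := Nat.exists_eq_add_of_le h
    exact (key n hn k).symm

/-- Equivalence of rays is an equivalence relation. -/
instance raySetoid (G : Graph α β) : Setoid G.Ray where
  r := Ray.Equivalent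
  iseqv := by
    refine ⟨Ray.equivalent_refl, fun {R R'} h S hS hSV ↦ ?_, fun {R R' R''} h h' S hS hSV ↦ ?_⟩
    · obtain ⟨N, hN⟩ := h S hS hSV
      exact ⟨N, fun m n hm hn ↦ (hN n m hn hm).symm⟩
    · obtain ⟨N, hN⟩ := h S hS hSV
      obtain ⟨N', hN'⟩ := h' S hS hSV
      exact ⟨max N N', fun m n hm hn ↦
        (hN m (max N N') (by omega) (by omega)).trans (hN' (max N N') n (by omega) (by omega))⟩

/-- The ends of `G`: the equivalence classes of its rays. -/
def Ends (G : Graph α β) : Type _ := Quotient (raySetoid G)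

/-- The end that contains the ray `R`. -/
def Ray.toEnd {G : Graph α β} (R : G.Ray) : G.Ends := Quotient.mk (raySetoid G) R

/-- The union of the set of vertices and the set of ends of `G`. -/
abbrev VertexOrEnd (G : Graph α β) : Type _ := V(G) ⊕ G.Ends

/-- `R` is an `S`–`ω` ray: a ray of the end `ω` that meets `S` exactly in its first vertex. -/
def Ray.IsRayFromTo {G : Graph α β} (R : G.Ray) (S : Set α) (ω : G.Ends) : Prop :=
  R.toEnd = ω ∧ R.vertex 0 ∈ S ∧ ∀ n, R.vertex (n + 1) ∉ S

/-- There are `k` pairwise edge-disjoint `S`–`ω` rays. -/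
def HasEdgeDisjointRays (G : Graph α β) (S : Set α) (ω : G.Ends) (k : ℕ) : Prop :=
  ∃ R : Fin k → G.Ray, (∀ i, (R i).IsRayFromTo S ω) ∧
    ∀ i j, i ≠ j → Disjoint (R i).edges (R j).edges

/-- An end `ω` is even if there is a finite vertex set `S` such that for every finite vertex set
`S' ⊇ S` the maximum number of edge-disjoint `S'`–`ω` rays is even. -/
def IsEvenEnd (G : Graph α β) (ω : G.Ends) : Prop :=
  ∃ S : Set α, S.Finite ∧ S ⊆ V(G) ∧
    ∀ S' : Set α, S'.Finite → S' ⊆ V(G) → S ⊆ S' →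
      ∃ n, IsGreatest {k | G.HasEdgeDisjointRays S' ω k} n ∧ Even n

/-- `G` is inner-Eulerian for `T`: all vertices and all ends outside `T` are even. -/
def IsInnerEulerian (G : Graph α β) (T : Set G.VertexOrEnd) : Prop :=
  (∀ x : V(G), Sum.inl x ∉ T → G.IsEvenVertex x) ∧
    ∀ ω : G.Ends, Sum.inr ω ∉ T → G.IsEvenEnd ω

/-- `T` lives in the vertex set `C`: all vertices of `T` lie in `C`, and all rays of ends in `T`
have tails in the subgraph induced by `C`. -/
def LivesIn (G : Graph α β) (T : Set G.VertexOrEnd) (C : Set α) : Prop :=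
  (∀ x : V(G), Sum.inl x ∈ T → (x : α) ∈ C) ∧
    ∀ R : G.Ray, Sum.inr R.toEnd ∈ T → R.HasTailIn C

/-- The set of all edges of `G` with one endvertex in `A` and the other in `B`. -/
def edgesBetween (G : Graph α β) (A B : Set α) : Set β :=
  {e | ∃ x ∈ A, ∃ y ∈ B, G.IsLink e x y}

/-- `F` is the cut of `G` with sides `A` and `B`. -/
def IsCutWithSides (G : Graph α β) (F : Set β) (A B : Set α) : Prop :=
  A ∪ B = V(G) ∧ Disjoint A B ∧ F = G.edgesBetween A B

end Graph

namespace Graph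

variable {α β : Type*}

/-! Let `T` live in `A`. Then all vertices of `B`, and all ends with a ray that has a tail in `B`,
are even. If the cut is odd, a contradiction arises from a ray with a tail in `B` whose end is not
even. For finite `B` summing degrees would suffice; in general the oddness must escape to an end.
Write d(X) for `cutOrder X`.

The end comes from a decreasing sequence of connected sets `C n` in `B` with finite odd boundaries,
where `C (n + 1)` avoids the inner ends of the boundary of `C n`, and no set between `C (n + 1)` and
`C n` has cut order below d(`C n`). By a Menger-type argument, d(`C n`) edge-disjoint rays start at
the boundary of `C n` and run through all later sets (`IsLinkedSequence.exists_rays`). The sets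
leave every finite set, so all these rays lie in one end. Rays of this end that start outside `C n`
must cross its boundary, so for arbitrarily large finite vertex sets the maximum number of rays is
some d(`C n`), which is odd (`IsLinkedSequence.exists_not_isEvenEnd`).

To build the sequence, `B` is kept partitioned into connected even pieces, and `C` is an odd union
of pieces in which every union of pieces with cut order below d(`C`) is a finite union, hence even.
Zorn's lemma provides such a partition (`IsEvenPartition.exists_stage`). Deleting the finitely many
pieces that meet a given finite set keeps `C` odd, and the next set `C'` is found in the remainder.
If `C' ⊆ E ⊆ C` and d(`E`) < d(`C`), then `E` can be uncrossed into a union of pieces, without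
increasing its cut order and without losing `C'`; this makes `C'` a finite union of even pieces,
which is absurd (`IsOddStage.exists_next`). Solidity of the pieces is what permits uncrossing. -/

/-- The set of edges with exactly one endvertex in `C`. -/
def boundary (G : Graph α β) (C : Set α) : Set β := {e | ∃ x y, G.IsLink e x y ∧ x ∈ C ∧ y ∉ C}

/-- The number of edges with exactly one endvertex in `C` (junk value `0` if it is infinite). -/
noncomputable def cutOrder (G : Graph α β) (C : Set α) : ℕ := (G.boundary C).ncard

/-! ### Submodularity, parity and limits of cut orders -/

section Boundary

variable {G : Graph α β} {C D P Q K E : Set α} {e : β} {x y : α}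

lemma IsLink.mem_boundary_iff (h : G.IsLink e x y) : e ∈ G.boundary C ↔ ¬(x ∈ C ↔ y ∈ C) := by
  constructor
  · rintro ⟨a, b, hab, ha, hb⟩
    rcases hab.eq_and_eq_or_eq_and_eq h with ⟨rfl, rfl⟩ | ⟨rfl, rfl⟩ <;> tauto
  · intro hxy
    by_cases hx : x ∈ C
    · exact ⟨x, y, h, hx, by tauto⟩
    · exact ⟨y, x, h.symm, by tauto, hx⟩

lemma exists_isLink_of_mem_boundary (h : e ∈ G.boundary C) : ∃ x y, G.IsLink e x y := by
  obtain ⟨x, y, hxy, -⟩ := h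
  exact ⟨x, y, hxy⟩

lemma boundary_compl (C : Set α) : G.boundary Cᶜ = G.boundary C := by
  ext e
  constructor <;> intro h <;> obtain ⟨x, y, hxy⟩ := exists_isLink_of_mem_boundary h <;>
    rw [hxy.mem_boundary_iff] at h ⊢ <;> simp only [Set.mem_compl_iff] at * <;> tauto

lemma cutOrder_compl (C : Set α) : G.cutOrder Cᶜ = G.cutOrder C := by
  rw [cutOrder, boundary_compl, cutOrder]

lemma boundary_inter_subset : G.boundary (P ∩ Q) ⊆ G.boundary P ∪ G.boundary Q := by
  intro e h
  obtain ⟨x, y, hxy⟩ := exists_isLink_of_mem_boundary h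
  rw [Set.mem_union, hxy.mem_boundary_iff, hxy.mem_boundary_iff]
  rw [hxy.mem_boundary_iff] at h
  simp only [Set.mem_inter_iff] at h
  tauto

lemma finite_boundary_inter (hP : (G.boundary P).Finite) (hQ : (G.boundary Q).Finite) :
    (G.boundary (P ∩ Q)).Finite := (hP.union hQ).subset boundary_inter_subset

lemma finite_boundary_compl (hP : (G.boundary P).Finite) : (G.boundary Pᶜ).Finite := by
  rwa [boundary_compl]

lemma finite_boundary_diff (hP : (G.boundary P).Finite) (hQ : (G.boundary Q).Finite) :
    (G.boundary (P \ Q)).Finite := by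
  rw [Set.sdiff_eq]
  exact finite_boundary_inter hP (finite_boundary_compl hQ)

lemma finite_boundary_union (hP : (G.boundary P).Finite) (hQ : (G.boundary Q).Finite) :
    (G.boundary (P ∪ Q)).Finite := by
  rw [← boundary_compl, Set.compl_union]
  exact finite_boundary_inter (finite_boundary_compl hP) (finite_boundary_compl hQ)

/-- Submodularity: edges between `P \ Q` and `Q \ P` count only on the right, all others equally on
both sides. -/
lemma cutOrder_inter_add_cutOrder_union_le (hP : (G.boundary P).Finite)
    (hQ : (G.boundary Q).Finite) :
    G.cutOrder (P ∩ Q) + G.cutOrder (P ∪ Q) ≤ G.cutOrder P + G.cutOrder Q := by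
  simp only [cutOrder]
  rw [← Set.ncard_union_add_ncard_inter _ _ hP hQ,
    ← Set.ncard_union_add_ncard_inter _ _ (finite_boundary_inter hP hQ)
      (finite_boundary_union hP hQ)]
  refine add_le_add (Set.ncard_le_ncard ?_ (hP.union hQ))
    (Set.ncard_le_ncard ?_ (hP.inter_of_left _))
  all_goals
    intro e h
    obtain ⟨x, y, hxy⟩ : ∃ x y, G.IsLink e x y := by
      first
      | exact exists_isLink_of_mem_boundary h.1
      | exact h.elim exists_isLink_of_mem_boundary exists_isLink_of_mem_boundary
    simp only [Set.mem_union, Set.mem_inter_iff, hxy.mem_boundary_iff] at h ⊢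
    tauto

/-- This is submodularity for `P` and `Qᶜ`. -/
lemma cutOrder_diff_add_cutOrder_diff_le (hP : (G.boundary P).Finite)
    (hQ : (G.boundary Q).Finite) :
    G.cutOrder (P \ Q) + G.cutOrder (Q \ P) ≤ G.cutOrder P + G.cutOrder Q := by
  have h := cutOrder_inter_add_cutOrder_union_le hP (finite_boundary_compl hQ)
  rw [cutOrder_compl, ← cutOrder_compl (P ∪ Qᶜ), Set.compl_union, compl_compl, ← Set.sdiff_eq,
    Set.inter_comm, ← Set.sdiff_eq] at h
  exact h

/-- The sets `K \ E`, `E` and `Kᶜ` partition the ground set, so an edge between two different parts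
lies in exactly two of the three boundaries. -/
lemma even_cutOrder_diff_add (hK : (G.boundary K).Finite) (hE : (G.boundary E).Finite)
    (hEK : E ⊆ K) : Even (G.cutOrder (K \ E) + G.cutOrder E + G.cutOrder K) := by
  have h1 : G.boundary K ∪ G.boundary E = G.boundary (K \ E) ∪ (G.boundary K ∩ G.boundary E) := by
    ext e
    by_cases h : ∃ x y, G.IsLink e x y
    · obtain ⟨x, y, hxy⟩ := h
      have hx := @hEK x
      have hy := @hEK y
      simp only [Set.mem_union, Set.mem_inter_iff, hxy.mem_boundary_iff, Set.mem_sdiff]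
      tauto
    · have h' : ∀ C, e ∉ G.boundary C := fun C hC ↦ h (exists_isLink_of_mem_boundary hC)
      simp [h']
  have h2 : Disjoint (G.boundary (K \ E)) (G.boundary K ∩ G.boundary E) := by
    rw [Set.disjoint_left]
    rintro e h ⟨h', h''⟩
    obtain ⟨x, y, hxy⟩ := exists_isLink_of_mem_boundary h
    have hx := @hEK x
    have hy := @hEK y
    simp only [hxy.mem_boundary_iff, Set.mem_sdiff] at h h' h''
    tauto
  have h3 := Set.ncard_union_eq h2 (finite_boundary_diff hK hE) (hK.inter_of_left _)
  have h4 := Set.ncard_union_add_ncard_inter _ _ hK hE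
  rw [h1, h3] at h4
  simp only [cutOrder]
  exact ⟨(G.boundary (K \ E)).ncard + (G.boundary K ∩ G.boundary E).ncard, by omega⟩

/-- `C` induces a connected subgraph: each nontrivial partition of `C` is crossed by an edge. -/
def IsConnectedSet (G : Graph α β) (C : Set α) : Prop :=
  ∀ D : Set α, (C ∩ D).Nonempty → (C \ D).Nonempty →
    ∃ e x y, G.IsLink e x y ∧ x ∈ C ∩ D ∧ y ∈ C \ D

lemma isConnectedSet_singleton (x : α) : G.IsConnectedSet {x} := by
  rintro D ⟨y, rfl, hy⟩ ⟨z, rfl, hz⟩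
  exact absurd hy hz

/-- An edge of the boundary of `D` lies in the boundary of a component of `D`. -/
lemma exists_component (hD : (G.boundary D).Nonempty) :
    ∃ K ⊆ D, G.IsConnectedSet K ∧ (G.boundary K).Nonempty ∧
      (∀ e x y, G.IsLink e x y → x ∈ K → y ∈ D → y ∈ K) := by
  obtain ⟨e, x, y, hxy, hx, hy⟩ := hD
  let r : α → α → Prop := fun a b ↦ a ∈ D ∧ b ∈ D ∧ G.Adj a b
  have hKD : ∀ z, Relation.ReflTransGen r x z → z ∈ D := by
    intro z hz
    rcases hz.cases_tail with rfl | ⟨w, -, hw⟩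
    · exact hx
    · exact hw.2.1
  refine ⟨{z | Relation.ReflTransGen r x z}, hKD, ?_,
    ⟨e, x, y, hxy, Relation.ReflTransGen.refl, fun h ↦ hy (hKD y h)⟩, ?_⟩
  · rintro S ⟨a, ha, haS⟩ ⟨b, hb, hbS⟩
    have cross : ∀ T : Set α, x ∈ T → ∀ z, Relation.ReflTransGen r x z → z ∉ T →
        ∃ u v, Relation.ReflTransGen r x u ∧ Relation.ReflTransGen r x v ∧ G.Adj u v ∧
          u ∈ T ∧ v ∉ T := by
      intro T hxT z hz
      induction hz with
      | refl => exact fun h ↦ absurd hxT h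
      | @tail u v hu huv ih =>
        intro hv
        by_cases huT : u ∈ T
        · exact ⟨u, v, hu, hu.tail huv, huv.2.2, huT, hv⟩
        · exact ih huT
    by_cases hxS : x ∈ S
    · obtain ⟨u, v, hu, hv, ⟨f, hf⟩, huS, hvS⟩ := cross S hxS b hb hbS
      exact ⟨f, u, v, hf, ⟨hu, huS⟩, hv, hvS⟩
    · obtain ⟨u, v, hu, hv, ⟨f, hf⟩, huS, hvS⟩ := cross Sᶜ hxS a ha (by simpa using haS)
      exact ⟨f, v, u, hf.symm, ⟨hv, by simpa using hvS⟩, hu, huS⟩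
  · intro f u v huv hu hv
    exact Relation.ReflTransGen.tail hu ⟨hKD u hu, hv, f, huv⟩

lemma cutOrder_add_cutOrder_diff_of_closed (hD : (G.boundary D).Finite) (hKD : K ⊆ D)
    (hK : ∀ e x y, G.IsLink e x y → x ∈ K → y ∈ D → y ∈ K) :
    (G.boundary K).Finite ∧ G.cutOrder K + G.cutOrder (D \ K) = G.cutOrder D := by
  have h1 : G.boundary K ∪ G.boundary (D \ K) = G.boundary D := by
    ext e
    by_cases h : ∃ x y, G.IsLink e x y
    · obtain ⟨x, y, hxy⟩ := h
      have hx := @hKD x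
      have hy := @hKD y
      have h1 := hK e x y hxy
      have h2 := hK e y x hxy.symm
      simp only [Set.mem_union, hxy.mem_boundary_iff, Set.mem_sdiff]
      tauto
    · have h' : ∀ C, e ∉ G.boundary C := fun C hC ↦ h (exists_isLink_of_mem_boundary hC)
      simp [h']
  have h2 : Disjoint (G.boundary K) (G.boundary (D \ K)) := by
    rw [Set.disjoint_left]
    intro e h h'
    obtain ⟨x, y, hxy⟩ := exists_isLink_of_mem_boundary h
    have hx := @hKD x
    have hy := @hKD y
    have h1 := hK e x y hxy
    have h2 := hK e y x hxy.symm
    simp only [hxy.mem_boundary_iff, Set.mem_sdiff] at h h'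
    tauto
  have hf : (G.boundary K).Finite := hD.subset (h1 ▸ Set.subset_union_left)
  refine ⟨hf, ?_⟩
  simp only [cutOrder]
  rw [← h1, Set.ncard_union_eq h2 hf (hD.subset (h1 ▸ Set.subset_union_right))]

/-- Lower semicontinuity of the cut order along directed unions. -/
lemma cutOrder_iUnion_le {ι : Type*} [Nonempty ι] (P : ι → Set α) (hP : Directed (· ⊆ ·) P)
    (n : ℕ) (hfin : ∀ i, (G.boundary (P i)).Finite)
    (hle : ∀ i, ∃ j, P i ⊆ P j ∧ G.cutOrder (P j) ≤ n) :
    (G.boundary (⋃ i, P i)).Finite ∧ G.cutOrder (⋃ i, P i) ≤ n := by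
  classical
  -- A boundary edge of the union has its outer end in no `P j` and its inner end in all large `P
  -- j`, so finitely many such edges are boundary edges of all large `P j` simultaneously.
  have key : ∀ F : Finset β, ↑F ⊆ G.boundary (⋃ i, P i) →
      ∃ i, ∀ j, P i ⊆ P j → ↑F ⊆ G.boundary (P j) := by
    intro F
    induction F using Finset.induction_on with
    | empty => exact fun _ ↦ ⟨Classical.arbitrary ι, by simp⟩
    | insert e F he ih =>
      intro hF
      rw [Finset.coe_insert, Set.insert_subset_iff] at hF
      obtain ⟨i, hi'⟩ := ih hF.2
      obtain ⟨x, y, hxy, hx, hy⟩ := hF.1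
      obtain ⟨j, hj⟩ := Set.mem_iUnion.1 hx
      obtain ⟨l, hil, hjl⟩ := hP i j
      refine ⟨l, fun m hm ↦ ?_⟩
      rw [Finset.coe_insert, Set.insert_subset_iff]
      exact ⟨⟨x, y, hxy, hm (hjl hj), fun h ↦ hy (Set.mem_iUnion.2 ⟨m, h⟩)⟩,
        hi' m (hil.trans hm)⟩
  have hcard : ∀ F : Finset β, ↑F ⊆ G.boundary (⋃ i, P i) → F.card ≤ n := by
    intro F hF
    obtain ⟨i, hi⟩ := key F hF
    obtain ⟨j, hij, hj⟩ := hle i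
    rw [← Set.ncard_coe_finset]
    exact (Set.ncard_le_ncard (hi j hij) (hfin j)).trans hj
  have hfinU : (G.boundary (⋃ i, P i)).Finite := by
    by_contra hinf
    obtain ⟨F, hF, hF'⟩ := Set.Infinite.exists_subset_card_eq hinf (n + 1)
    have := hcard F hF
    omega
  refine ⟨hfinU, ?_⟩
  have := hcard hfinU.toFinset (by simp)
  rwa [← Set.ncard_eq_toFinset_card _ hfinU] at this

end Boundary

/-! ### Even partitions, uncrossing and odd stages -/

/-- The equivalence class of `x`. -/
def block (s : Setoid α) (x : α) : Set α := {y | s.r x y}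

/-- `D` is a union of equivalence classes. -/
def Respects (s : Setoid α) (D : Set α) : Prop := ∀ x y, s.r x y → x ∈ D → y ∈ D

/-- `D` is covered by finitely many equivalence classes. -/
def FinitelyCovered (s : Setoid α) (D : Set α) : Prop := ∃ t : Finset α, D ⊆ ⋃ x ∈ t, block s x

/-- In every partition of `P` into two parts by a finite cut, one part has at least as large a cut
order as `P`. -/
def IsSolid (G : Graph α β) (P : Set α) : Prop :=
  ∀ E : Set α, (G.boundary E).Finite →
    G.cutOrder P ≤ G.cutOrder (P ∩ E) ∨ G.cutOrder P ≤ G.cutOrder (P \ E)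

/-- The equivalence classes of the elements of `B` are connected solid subsets of `B` whose
boundary is finite and even. -/
structure IsEvenPartition (G : Graph α β) (B : Set α) (s : Setoid α) : Prop where
  subset : ∀ x ∈ B, block s x ⊆ B
  connected : ∀ x ∈ B, G.IsConnectedSet (block s x)
  finite : ∀ x ∈ B, (G.boundary (block s x)).Finite
  even : ∀ x ∈ B, Even (G.cutOrder (block s x))
  solid : ∀ x ∈ B, G.IsSolid (block s x)

/-- A connected union `C` of classes of an even partition, with an odd cut, such that all unions of
classes in `C` of smaller cut order are finite unions. -/
structure IsOddStage (G : Graph α β) (B : Set α) (s : Setoid α) (C : Set α) : Prop where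
  partition : G.IsEvenPartition B s
  subset : C ⊆ B
  respects : Respects s C
  connected : G.IsConnectedSet C
  finite : (G.boundary C).Finite
  odd : Odd (G.cutOrder C)
  covered : ∀ D ⊆ C, Respects s D → (G.boundary D).Finite → G.cutOrder D < G.cutOrder C →
    FinitelyCovered s D

section Partition

variable {G : Graph α β} {B C D P Q K E : Set α} {s s' : Setoid α} {e : β} {x y : α}

lemma mem_block_self : x ∈ block s x := s.refl x

lemma Respects.block_subset (h : Respects s D) (hx : x ∈ D) : block s x ⊆ D :=
  fun y hy ↦ h x y hy hx

lemma respects_block : Respects s (block s x) := fun _ _ h hx ↦ s.trans hx h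

lemma Respects.diff (h : Respects s D) (h' : Respects s E) : Respects s (D \ E) :=
  fun x y hxy hx ↦ ⟨h x y hxy hx.1, fun hy ↦ hx.2 (h' y x (s.symm hxy) hy)⟩

lemma Respects.mono (h : Respects s' D) (hle : s ≤ s') : Respects s D :=
  fun x y hxy hx ↦ h x y (hle hxy) hx

lemma FinitelyCovered.union (h : FinitelyCovered s D) (h' : FinitelyCovered s E) :
    FinitelyCovered s (D ∪ E) := by
  classical
  obtain ⟨t, ht⟩ := h
  obtain ⟨t', ht'⟩ := h'
  refine ⟨t ∪ t', ?_⟩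
  rw [Finset.set_biUnion_union]
  exact Set.union_subset_union ht ht'

lemma FinitelyCovered.subset (h : FinitelyCovered s D) (h' : E ⊆ D) : FinitelyCovered s E := by
  obtain ⟨t, ht⟩ := h
  exact ⟨t, h'.trans ht⟩

/-- A class meeting `K` lies in `D` and is connected; were it not inside `K`, one of its edges would
leave `K` within `D`. -/
lemma IsEvenPartition.respects_of_closed (hs : G.IsEvenPartition B s) (hDB : D ⊆ B)
    (hD : Respects s D) (hKD : K ⊆ D) (hK : ∀ e x y, G.IsLink e x y → x ∈ K → y ∈ D → y ∈ K) :
    Respects s K := by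
  intro x y hxy hx
  by_contra hy
  obtain ⟨e, u, v, huv, hu, hv⟩ := hs.connected x (hDB (hKD hx)) K ⟨x, mem_block_self, hx⟩
    ⟨y, hxy, hy⟩
  exact hv.2 (hK e u v huv hu.2 (hD.block_subset (hKD hx) hv.1))

lemma IsEvenPartition.even_of_finitelyCovered (hs : G.IsEvenPartition B s) (hDB : D ⊆ B)
    (hD : Respects s D) (hfc : FinitelyCovered s D) :
    (G.boundary D).Finite ∧ Even (G.cutOrder D) := by
  classical
  obtain ⟨t, ht⟩ := hfc
  induction t using Finset.induction_on generalizing D with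
  | empty =>
    have : D = ∅ := by simpa using ht
    subst this
    have : G.boundary ∅ = ∅ := by ext; simp [boundary]
    simp [cutOrder, this]
  | insert a t ha ih =>
    rw [Finset.set_biUnion_insert] at ht
    by_cases haD : a ∈ D
    · have hsub := hD.block_subset haD
      obtain ⟨h1, h2⟩ := ih (D := D \ block s a) (Set.sdiff_subset.trans hDB)
        (hD.diff respects_block) (by
          rintro z ⟨hz, hz'⟩
          exact (ht hz).resolve_left hz')
      have h3 := hs.finite a (hDB haD)
      have hfin : (G.boundary D).Finite := by
        have := finite_boundary_union h1 h3
        rwa [Set.sdiff_union_of_subset hsub] at this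
      have h4 := even_cutOrder_diff_add hfin h3 hsub
      rw [Nat.even_add, Nat.even_add] at h4
      exact ⟨hfin, by simpa [h2, hs.even a (hDB haD)] using h4⟩
    · refine ih hDB hD fun z hz ↦ (ht hz).resolve_left fun hz' ↦ haD ?_
      exact hD z a (s.symm hz') hz

/-- A subset of a union of classes can be uncrossed from all classes. -/
lemma IsEvenPartition.exists_uncrossing (hs : G.IsEvenPartition B s) (hKB : K ⊆ B)
    (hK : Respects s K) (hKf : (G.boundary K).Finite) (hEK : E ⊆ K) (hE : (G.boundary E).Finite) :
    ∃ E' ⊆ K, Respects s E' ∧ (G.boundary E').Finite ∧ G.cutOrder E' ≤ G.cutOrder E ∧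
      G.cutOrder (K \ E') ≤ G.cutOrder (K \ E) ∧ ∀ Q ⊆ E, Respects s Q → Q ⊆ E' := by
  -- The measure is the number of boundary edges of `E` inside classes. Absorbing or discarding a
  -- split class lowers it, because that class is connected.
  induction hn : {e ∈ G.boundary E | ∃ x y, G.IsLink e x y ∧ s.r x y}.ncard
    using Nat.strong_induction_on generalizing E with
  | _ n ih =>
  by_cases hEr : Respects s E
  · exact ⟨E, hEK, hEr, hE, le_rfl, le_rfl, fun Q hQ _ ↦ hQ⟩
  simp only [Respects, not_forall] at hEr
  obtain ⟨x, y, hxy, hx, hy⟩ := hEr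
  have hxB := hKB (hEK hx)
  have hPK := hK.block_subset (hEK hx)
  have hPf := hs.finite x hxB
  obtain ⟨f, u, v, huv, hu, hv⟩ := hs.connected x hxB E ⟨x, mem_block_self, hx⟩ ⟨y, hxy, hy⟩
  have descend : ∀ E₁ : Set α, (∀ z, z ∉ block s x → (z ∈ E₁ ↔ z ∈ E)) →
      (∀ z ∈ block s x, ∀ w ∈ block s x, (z ∈ E₁ ↔ w ∈ E₁)) →
      {e ∈ G.boundary E₁ | ∃ x y, G.IsLink e x y ∧ s.r x y}.ncard < n := by
    intro E₁ h1 h2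
    rw [← hn]
    refine Set.ncard_lt_ncard ⟨?_, ?_⟩ (hE.subset (Set.sep_subset _ _))
    · rintro e ⟨he, a, b, hab, hsab⟩
      refine ⟨?_, a, b, hab, hsab⟩
      rw [hab.mem_boundary_iff] at he ⊢
      by_cases ha : a ∈ block s x
      · exact absurd (h2 a ha b (s.trans ha hsab)) he
      · have hb : b ∉ block s x := fun hb ↦ ha (s.trans hb (s.symm hsab))
        rwa [h1 a ha, h1 b hb] at he
    · intro hsub
      have hf := (hsub ⟨huv.mem_boundary_iff.2 fun h ↦ hv.2 (h.1 hu.2), u, v, huv,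
        s.trans (s.symm hu.1) hv.1⟩).1
      rw [huv.mem_boundary_iff] at hf
      exact hf (h2 u hu.1 v hv.1)
  -- Solidity decides whether the class is added to `E` or removed from it. In both cases
  -- submodularity and its difference form bound the new cut orders of `E` and of `K \ E` by the old
  -- ones.
  rcases hs.solid x hxB E hE with h | h
  · have hE₁f := finite_boundary_union hE hPf
    have hE₁K : E ∪ block s x ⊆ K := Set.union_subset hEK hPK
    obtain ⟨E', h1, h2, h3, h4, h5, h6⟩ := ih _ (descend (E ∪ block s x)
      (fun z hz ↦ by simp [hz]) (fun z hz w hw ↦ by simp [hz, hw])) hE₁K hE₁f rfl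
    refine ⟨E', h1, h2, h3, h4.trans ?_, h5.trans ?_,
      fun Q hQ hQ' ↦ h6 Q (hQ.trans Set.subset_union_left) hQ'⟩
    · have := cutOrder_inter_add_cutOrder_union_le hE hPf
      rw [Set.inter_comm] at this
      omega
    · have := cutOrder_diff_add_cutOrder_diff_le (finite_boundary_diff hKf hE) hPf
      have e1 : (K \ E) \ block s x = K \ (E ∪ block s x) := by
        ext z; simp only [Set.mem_sdiff, Set.mem_union]; tauto
      have e2 : block s x \ (K \ E) = block s x ∩ E := by
        ext z
        have := @hPK z
        simp only [Set.mem_sdiff, Set.mem_inter_iff]; tauto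
      rw [e1, e2] at this
      omega
  · have hE₁f := finite_boundary_diff hE hPf
    have hE₁K : E \ block s x ⊆ K := Set.sdiff_subset.trans hEK
    obtain ⟨E', h1, h2, h3, h4, h5, h6⟩ := ih _ (descend (E \ block s x)
      (fun z hz ↦ by simp [hz]) (fun z hz w hw ↦ by simp [hz, hw])) hE₁K hE₁f rfl
    refine ⟨E', h1, h2, h3, h4.trans ?_, h5.trans ?_, fun Q hQ hQ' ↦ h6 Q (fun z hz ↦
      ⟨hQ hz, fun hz' ↦ hy (hQ (hQ' z y (s.trans (s.symm hz') hxy) hz))⟩) hQ'⟩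
    · have := cutOrder_diff_add_cutOrder_diff_le hE hPf
      omega
    · have := cutOrder_inter_add_cutOrder_union_le (finite_boundary_diff hKf hE) hPf
      have e1 : (K \ E) ∪ block s x = K \ (E \ block s x) := by
        ext z
        have := @hPK z
        simp only [Set.mem_sdiff, Set.mem_union]; tauto
      have e2 : (K \ E) ∩ block s x = block s x \ E := by
        ext z
        have := @hPK z
        simp only [Set.mem_sdiff, Set.mem_inter_iff]; tauto
      rw [e1, e2] at this
      omega

/-- One of the two alternatives of solidity holds for cofinally many `P j`, say the one for `E`.
With `U` the union, submodularity gives d((`U ∩ E`) ∪ `P j`) ≤ d(`U ∩ E`) for these `j`; the sets on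
the left exhaust `U`, so semicontinuity applies. -/
lemma isSolid_iUnion {ι : Type*} [Nonempty ι] (P : ι → Set α) (hP : Directed (· ⊆ ·) P)
    (hfin : ∀ i, (G.boundary (P i)).Finite) (hU : (G.boundary (⋃ i, P i)).Finite)
    (hsolid : ∀ i, G.IsSolid (P i)) : G.IsSolid (⋃ i, P i) := by
  have key : ∀ E, (G.boundary E).Finite →
      (∀ i, ∃ j, P i ⊆ P j ∧ G.cutOrder (P j) ≤ G.cutOrder (P j ∩ E)) →
      G.cutOrder (⋃ i, P i) ≤ G.cutOrder ((⋃ i, P i) ∩ E) := by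
    intro E hE h
    have hUE := finite_boundary_inter hU hE
    have e : ⋃ i, ((⋃ i, P i) ∩ E ∪ P i) = ⋃ i, P i := by
      rw [← Set.union_iUnion, Set.union_eq_right]
      exact Set.inter_subset_left
    have := (cutOrder_iUnion_le (G := G) (fun i ↦ (⋃ i, P i) ∩ E ∪ P i) ?_
      (G.cutOrder ((⋃ i, P i) ∩ E)) (fun i ↦ finite_boundary_union hUE (hfin i)) ?_).2
    · rwa [e] at this
    · intro i j
      obtain ⟨k, hk, hk'⟩ := hP i j
      exact ⟨k, Set.union_subset_union_right _ hk, Set.union_subset_union_right _ hk'⟩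
    · intro i
      obtain ⟨j, hij, hj⟩ := h i
      refine ⟨j, Set.union_subset_union_right _ hij, ?_⟩
      have h1 := cutOrder_inter_add_cutOrder_union_le hUE (hfin j)
      have e1 : (⋃ i, P i) ∩ E ∩ P j = P j ∩ E := by
        ext z
        have : z ∈ P j → z ∈ ⋃ i, P i := fun hz ↦ Set.mem_iUnion.2 ⟨j, hz⟩
        simp only [Set.mem_inter_iff]; tauto
      rw [e1] at h1
      omega
  intro E hE
  by_cases h : ∀ i, ∃ j, P i ⊆ P j ∧ G.cutOrder (P j) ≤ G.cutOrder (P j ∩ E)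
  · exact Or.inl (key E hE h)
  · right
    push Not at h
    obtain ⟨i, hi⟩ := h
    rw [Set.sdiff_eq]
    refine key Eᶜ (finite_boundary_compl hE) fun l ↦ ?_
    obtain ⟨j, hij, hlj⟩ := hP i l
    refine ⟨j, hlj, ?_⟩
    rw [← Set.sdiff_eq]
    exact (hsolid j E hE).resolve_left (by simpa using hi j hij)

lemma isConnectedSet_iUnion {ι : Type*} (P : ι → Set α) (hP : Directed (· ⊆ ·) P)
    (hconn : ∀ i, G.IsConnectedSet (P i)) : G.IsConnectedSet (⋃ i, P i) := by
  rintro D ⟨a, ha, haD⟩ ⟨b, hb, hbD⟩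
  obtain ⟨i, hi⟩ := Set.mem_iUnion.1 ha
  obtain ⟨j, hj⟩ := Set.mem_iUnion.1 hb
  obtain ⟨k, hik, hjk⟩ := hP i j
  obtain ⟨e, x, y, hxy, hx, hy⟩ := hconn k D ⟨a, hik hi, haD⟩ ⟨b, hjk hj, hbD⟩
  exact ⟨e, x, y, hxy, ⟨Set.subset_iUnion P k hx.1, hx.2⟩, Set.subset_iUnion P k hy.1, hy.2⟩

/-- The coarsenings of `s` that differ from `s` only by classes in `C` of cut order smaller than
that of `C`. -/
def coarsenings (G : Graph α β) (B C : Set α) (s : Setoid α) : Set (Setoid α) :=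
  {s' | s ≤ s' ∧ G.IsEvenPartition B s' ∧ Respects s' C ∧
    ∀ x ∈ B, block s' x = block s x ∨ x ∈ C ∧ G.cutOrder (block s' x) < G.cutOrder C}

/-- Classes of the union of a chain are directed unions of classes. Connectedness, solidity and the
bound on the cut order pass to the limit; parity does not, and is recovered from the minimality of
d(`C`) among odd unions. -/
lemma exists_upper_bound_coarsenings (hs : G.IsEvenPartition B s)
    (hmin : ∀ D ⊆ C, Respects s D → (G.boundary D).Finite → Odd (G.cutOrder D) →
      G.cutOrder C ≤ G.cutOrder D)
    (c : Set (Setoid α)) (hc : c ⊆ coarsenings G B C s) (hchain : IsChain (· ≤ ·) c)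
    (hne : c.Nonempty) : ∃ ub ∈ coarsenings G B C s, ∀ z ∈ c, z ≤ ub := by
  obtain ⟨s₀, hs₀⟩ := hne
  have : Nonempty c := ⟨⟨s₀, hs₀⟩⟩
  let u : Setoid α :=
    { r := fun x y ↦ ∃ z ∈ c, z.r x y
      iseqv := by
        refine ⟨fun x ↦ ⟨s₀, hs₀, s₀.refl x⟩, ?_, ?_⟩
        · rintro x y ⟨z, hz, h⟩
          exact ⟨z, hz, z.symm h⟩
        · rintro x y w ⟨z, hz, h⟩ ⟨z', hz', h'⟩
          rcases hchain.total hz hz' with hle | hle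
          · exact ⟨z', hz', z'.trans (hle h) h'⟩
          · exact ⟨z, hz, z.trans h (hle h')⟩ }
  have hblock : ∀ x, block u x = ⋃ z : c, block z.1 x := by
    intro x
    ext y
    simp only [block, Set.mem_iUnion]
    exact ⟨fun ⟨z, hz, h⟩ ↦ ⟨⟨z, hz⟩, h⟩, fun ⟨z, h⟩ ↦ ⟨z.1, z.2, h⟩⟩
  have hdir : ∀ x, Directed (· ⊆ ·) fun z : c ↦ block z.1 x := by
    intro x z z'
    rcases hchain.total z.2 z'.2 with hle | hle
    · exact ⟨z', fun y hy ↦ hle hy, subset_rfl⟩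
    · exact ⟨z, subset_rfl, fun y hy ↦ hle hy⟩
  have hsu : s ≤ u := fun {x y} h ↦ ⟨s₀, hs₀, (hc hs₀).1 h⟩
  have hC : Respects u C := by
    rintro x y ⟨z, hz, h⟩ hx
    exact (hc hz).2.2.1 x y h hx
  have hcases : ∀ x ∈ B, block u x = block s x ∨ x ∈ C ∧ (G.boundary (block u x)).Finite ∧
      G.cutOrder (block u x) < G.cutOrder C := by
    intro x hx
    by_cases h : ∀ z ∈ c, block z x = block s x
    · left
      rw [hblock]
      ext y
      simp only [Set.mem_iUnion, Subtype.exists]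
      exact ⟨fun ⟨z, hz, hy⟩ ↦ h z hz ▸ hy, fun hy ↦ ⟨s₀, hs₀, (h s₀ hs₀).symm ▸ hy⟩⟩
    · right
      push Not at h
      obtain ⟨z₁, hz₁, hne⟩ := h
      obtain ⟨hxC, hlt⟩ := ((hc hz₁).2.2.2 x hx).resolve_left hne
      -- Only weak inequalities survive limits, hence the bound d(`C`) - 1.
      have h1 := cutOrder_iUnion_le (G := G) (fun z : c ↦ block z.1 x) (hdir x)
        (G.cutOrder C - 1) (fun z ↦ (hc z.2).2.1.finite x hx) (fun z ↦ by
          obtain ⟨w, hw, hw'⟩ := hdir x z ⟨z₁, hz₁⟩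
          refine ⟨w, hw, ?_⟩
          have : block w.1 x ≠ block s x := by
            intro heq
            apply hne
            apply subset_antisymm
            · rw [← heq]
              exact hw'
            · exact fun y hy ↦ (hc hz₁).1 hy
          have := (((hc w.2).2.2.2 x hx).resolve_left this).2
          omega)
      rw [hblock]
      exact ⟨hxC, h1.1, by omega⟩
  have hfin : ∀ x ∈ B, (G.boundary (block u x)).Finite := by
    intro x hx
    rcases hcases x hx with h | h
    · rw [h]
      exact hs.finite x hx
    · exact h.2.1
  refine ⟨u, ⟨hsu, ⟨?_, ?_, hfin, ?_, ?_⟩, hC, ?_⟩, fun z hz x y h ↦ ⟨z, hz, h⟩⟩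
  · rintro x hx y ⟨z, hz, h⟩
    exact (hc hz).2.1.subset x hx h
  · intro x hx
    rw [hblock]
    exact isConnectedSet_iUnion _ (hdir x) fun z ↦ (hc z.2).2.1.connected x hx
  · intro x hx
    rcases hcases x hx with h | h
    · rw [h]
      exact hs.even x hx
    · by_contra hodd
      have := hmin (block u x) (hC.block_subset h.1) (respects_block.mono hsu) h.2.1
        (Nat.not_even_iff_odd.1 hodd)
      omega
  · intro x hx
    have hf := hfin x hx
    rw [hblock] at hf ⊢
    exact isSolid_iUnion _ (hdir x) (fun z ↦ (hc z.2).2.1.finite x hx) hf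
      fun z ↦ (hc z.2).2.1.solid x hx
  · intro x hx
    rcases hcases x hx with h | h
    · exact Or.inl h
    · exact Or.inr ⟨h.1, h.2.2⟩

/-- Merge all classes that meet `K`. -/
def mergeSetoid (s : Setoid α) (K : Set α) (hK : Respects s K) : Setoid α where
  r x y := s.r x y ∨ x ∈ K ∧ y ∈ K
  iseqv := by
    refine ⟨fun x ↦ Or.inl (s.refl x), ?_, ?_⟩
    · rintro x y (h | h)
      · exact Or.inl (s.symm h)
      · exact Or.inr h.symm
    · rintro x y z (h | h) (h' | h')
      · exact Or.inl (s.trans h h')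
      · exact Or.inr ⟨hK y x (s.symm h) h'.1, h'.2⟩
      · exact Or.inr ⟨h.1, hK y z h' h.2⟩
      · exact Or.inr ⟨h.1, h'.2⟩

lemma block_mergeSetoid_of_mem (hK : Respects s K) (hx : x ∈ K) :
    block (mergeSetoid s K hK) x = K := by
  ext y
  simp only [block]
  exact ⟨fun h ↦ h.elim (fun h ↦ hK x y h hx) And.right, fun h ↦ Or.inr ⟨hx, h⟩⟩

lemma block_mergeSetoid_of_notMem (hK : Respects s K) (hx : x ∉ K) :
    block (mergeSetoid s K hK) x = block s x := by
  ext y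
  simp only [block]
  exact ⟨fun h ↦ h.resolve_right fun h ↦ hx h.1, Or.inl⟩

/-- In a maximal coarsening, a union of infinitely many classes violating `covered`, chosen with
least cut order, has a component that could itself be merged into a single class. -/
lemma IsEvenPartition.exists_stage (hs : G.IsEvenPartition B s) (hCB : C ⊆ B)
    (hC : Respects s C) (hconn : G.IsConnectedSet C) (hfin : (G.boundary C).Finite)
    (hodd : Odd (G.cutOrder C))
    (hmin : ∀ D ⊆ C, Respects s D → (G.boundary D).Finite → Odd (G.cutOrder D) →
      G.cutOrder C ≤ G.cutOrder D) :
    ∃ s', G.IsOddStage B s' C := by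
  obtain ⟨m, -, hm, hmax⟩ := zorn_le_nonempty₀ (coarsenings G B C s)
    (fun c hc hchain y hy ↦ exists_upper_bound_coarsenings hs hmin c hc hchain ⟨y, hy⟩) s
    ⟨le_rfl, hs, hC, fun x _ ↦ Or.inl rfl⟩
  obtain ⟨hsm, hmp, hmC, hmb⟩ := hm
  refine ⟨m, hmp, hCB, hmC, hconn, hfin, hodd, ?_⟩
  by_contra hbad
  have hex : ∃ n, ∃ D ⊆ C, Respects m D ∧ (G.boundary D).Finite ∧ G.cutOrder D < G.cutOrder C ∧
      ¬FinitelyCovered m D ∧ G.cutOrder D = n := by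
    push Not at hbad
    obtain ⟨D, h1, h2, h3, h4, h5⟩ := hbad
    exact ⟨_, D, h1, h2, h3, h4, h5, rfl⟩
  classical
  obtain ⟨D, hDC, hDr, hDf, hDlt, hDcov, hDn⟩ := Nat.find_spec hex
  have hDmin : ∀ E ⊆ C, Respects m E → (G.boundary E).Finite → G.cutOrder E < G.cutOrder D →
      FinitelyCovered m E := by
    intro E h1 h2 h3 h4
    by_contra h5
    exact Nat.find_min hex (hDn ▸ h4) ⟨E, h1, h2, h3, h4.trans hDlt, h5, rfl⟩
  have hDb : (G.boundary D).Nonempty := by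
    have h1 : (C ∩ D).Nonempty := by
      rw [Set.inter_eq_right.2 hDC, Set.nonempty_iff_ne_empty]
      rintro rfl
      exact hDcov ⟨∅, by simp⟩
    have h2 : (C \ D).Nonempty := by
      rw [Set.sdiff_nonempty]
      intro h
      rw [subset_antisymm h hDC] at hDlt
      omega
    obtain ⟨e, x, y, hxy, hx, hy⟩ := hconn D h1 h2
    exact ⟨e, x, y, hxy, hx.2, hy.2⟩
  obtain ⟨K, hKD, hKconn, hKb, hKcl⟩ := exists_component hDb
  obtain ⟨hKf, hKadd⟩ := cutOrder_add_cutOrder_diff_of_closed hDf hKD hKcl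
  have hKpos : 0 < G.cutOrder K := (Set.ncard_pos hKf).2 hKb
  have hKr := hmp.respects_of_closed (hDC.trans hCB) hDr hKD hKcl
  have hKC := hKD.trans hDC
  -- Otherwise `D \ K`, whose cut order is smaller, would be finitely covered too, and hence `D`.
  have hKcov : ¬FinitelyCovered m K := by
    intro h
    have h' := hDmin (D \ K) (Set.sdiff_subset.trans hDC) (hDr.diff hKr)
      (finite_boundary_diff hDf hKf) (by omega)
    exact hDcov ((h.union h').subset (by simp))
  have hKlt : G.cutOrder K < G.cutOrder C := by omega
  have hKeven : Even (G.cutOrder K) := by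
    by_contra h
    have := hmin K hKC (hKr.mono hsm) hKf (Nat.not_even_iff_odd.1 h)
    omega
  -- If both parts of `K` had smaller cut order, so would their uncrossed versions; these would be
  -- finitely covered by the choice of `D`, and together they cover `K`.
  have hKsolid : G.IsSolid K := by
    intro E hE
    obtain ⟨E', h1, h2, h3, h4, h5, -⟩ := hmp.exists_uncrossing (hKC.trans hCB) hKr hKf
      (E := K ∩ E) Set.inter_subset_left (finite_boundary_inter hKf hE)
    rw [Set.sdiff_self_inter] at h5
    by_contra! hcon
    apply hKcov
    have c1 := hDmin E' (h1.trans hKC) h2 h3 (by omega)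
    have c2 := hDmin (K \ E') (Set.sdiff_subset.trans hKC) (hKr.diff h2)
      (finite_boundary_diff hKf h3) (by omega)
    exact (c1.union c2).subset (by simp)
  have hmem : mergeSetoid m K hKr ∈ coarsenings G B C s := by
    have hb : ∀ x, (x ∈ K ∧ block (mergeSetoid m K hKr) x = K) ∨
        (x ∉ K ∧ block (mergeSetoid m K hKr) x = block m x) := fun x ↦
      (em (x ∈ K)).imp (fun h ↦ ⟨h, block_mergeSetoid_of_mem hKr h⟩)
        fun h ↦ ⟨h, block_mergeSetoid_of_notMem hKr h⟩
    refine ⟨fun {x y} h ↦ Or.inl (hsm h), ⟨?_, ?_, ?_, ?_, ?_⟩, ?_, ?_⟩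
    · intro x hx
      rcases hb x with ⟨-, h⟩ | ⟨-, h⟩ <;> rw [h]
      exacts [hKC.trans hCB, hmp.subset x hx]
    · intro x hx
      rcases hb x with ⟨-, h⟩ | ⟨-, h⟩ <;> rw [h]
      exacts [hKconn, hmp.connected x hx]
    · intro x hx
      rcases hb x with ⟨-, h⟩ | ⟨-, h⟩ <;> rw [h]
      exacts [hKf, hmp.finite x hx]
    · intro x hx
      rcases hb x with ⟨-, h⟩ | ⟨-, h⟩ <;> rw [h]
      exacts [hKeven, hmp.even x hx]
    · intro x hx
      rcases hb x with ⟨-, h⟩ | ⟨-, h⟩ <;> rw [h]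
      exacts [hKsolid, hmp.solid x hx]
    · rintro x y (h | h) hx
      · exact hmC x y h hx
      · exact hKC h.2
    · intro x hx
      rcases hb x with ⟨h', h⟩ | ⟨-, h⟩
      · rw [h]
        exact Or.inr ⟨hKC h', hKlt⟩
      · rw [h]
        exact hmb x hx
  -- By maximality, `K` already lies in one class of `m`, against `hKcov`.
  have hle := hmax hmem fun {x y} h ↦ Or.inl h
  have hKne : K.Nonempty := by
    rw [Set.nonempty_iff_ne_empty]
    rintro rfl
    exact hKcov ⟨∅, by simp⟩
  obtain ⟨x, hx⟩ := hKne
  refine hKcov ⟨{x}, fun y hy ↦ ?_⟩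
  simp only [Finset.mem_singleton, Set.iUnion_iUnion_eq_left]
  exact hle (Or.inr ⟨hx, hy⟩)

/-- Among the odd unions of classes in `D`, one of least cut order has a component with nonempty
boundary. This component is odd, since otherwise the rest would be odd of smaller cut order; so it
inherits minimality. -/
lemma IsEvenPartition.exists_stage_subset (hs : G.IsEvenPartition B s) (hDB : D ⊆ B)
    (hD : Respects s D) (hfin : (G.boundary D).Finite) (hodd : Odd (G.cutOrder D)) :
    ∃ s' C, C ⊆ D ∧ Respects s C ∧ G.IsOddStage B s' C := by
  classical
  have hex : ∃ n, ∃ E ⊆ D, Respects s E ∧ (G.boundary E).Finite ∧ Odd (G.cutOrder E) ∧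
      G.cutOrder E = n := ⟨_, D, subset_rfl, hD, hfin, hodd, rfl⟩
  obtain ⟨E, hED, hEr, hEf, hEodd, hEn⟩ := Nat.find_spec hex
  have hEmin : ∀ E' ⊆ D, Respects s E' → (G.boundary E').Finite → Odd (G.cutOrder E') →
      G.cutOrder E ≤ G.cutOrder E' := by
    intro E' h1 h2 h3 h4
    rw [hEn]
    exact Nat.find_min' hex ⟨E', h1, h2, h3, h4, rfl⟩
  obtain ⟨K, hKE, hKconn, hKb, hKcl⟩ := exists_component
    ((Set.ncard_pos hEf).1 hEodd.pos)
  obtain ⟨hKf, hKadd⟩ := cutOrder_add_cutOrder_diff_of_closed hEf hKE hKcl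
  have hKpos : 0 < G.cutOrder K := (Set.ncard_pos hKf).2 hKb
  have hKr := hs.respects_of_closed (hED.trans hDB) hEr hKE hKcl
  have hKD := hKE.trans hED
  have hKodd : Odd (G.cutOrder K) := by
    by_contra h
    rw [Nat.not_odd_iff_even] at h
    have h1 : Odd (G.cutOrder (E \ K)) := by
      rw [← hKadd, Nat.odd_add, ← Nat.not_even_iff_odd] at hEodd
      rw [← Nat.not_even_iff_odd]
      tauto
    have := hEmin (E \ K) (Set.sdiff_subset.trans hED) (hEr.diff hKr)
      (finite_boundary_diff hEf hKf) h1
    omega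
  obtain ⟨s', hs'⟩ := hs.exists_stage (hKD.trans hDB) hKr hKconn hKf hKodd
    fun E' h1 h2 h3 h4 ↦ (by omega : G.cutOrder K ≤ G.cutOrder E).trans
      (hEmin E' (h1.trans hKD) h2 h3 h4)
  exact ⟨s', K, hKD, hKr, hs'⟩

lemma IsOddStage.exists_next (h : G.IsOddStage B s C) {X : Set α} (hX : X.Finite) :
    ∃ s' C', C' ⊆ C ∧ Disjoint C' X ∧ G.IsOddStage B s' C' ∧
      ∀ E, C' ⊆ E → E ⊆ C → (G.boundary E).Finite → G.cutOrder C ≤ G.cutOrder E := by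
  classical
  -- The union of the finitely many classes in `C` that meet `X`; it is even, so removing it keeps
  -- the cut odd.
  let Z : Set α := {y ∈ C | ∃ x ∈ X, s.r x y}
  have hZC : Z ⊆ C := Set.sep_subset _ _
  have hZr : Respects s Z := by
    rintro a b hab ⟨ha, x, hx, hxa⟩
    exact ⟨h.respects a b hab ha, x, hx, s.trans hxa hab⟩
  have hZcov : FinitelyCovered s Z := by
    refine ⟨hX.toFinset, ?_⟩
    rintro y ⟨-, x, hx, hxy⟩
    simp only [Set.Finite.mem_toFinset, Set.mem_iUnion]
    exact ⟨x, hx, hxy⟩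
  obtain ⟨hZf, hZe⟩ := h.partition.even_of_finitelyCovered (hZC.trans h.subset) hZr hZcov
  have hodd : Odd (G.cutOrder (C \ Z)) := by
    have h1 := even_cutOrder_diff_add h.finite hZf hZC
    have h2 := h.odd
    rw [← Nat.not_even_iff_odd] at h2 ⊢
    rw [Nat.even_add, Nat.even_add] at h1
    tauto
  obtain ⟨s', C', hC', hC'r, hst⟩ := h.partition.exists_stage_subset
    (Set.sdiff_subset.trans h.subset) (h.respects.diff hZr) (finite_boundary_diff h.finite hZf) hodd
  have hC'C := hC'.trans Set.sdiff_subset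
  refine ⟨s', C', hC'C, ?_, hst, ?_⟩
  · rw [Set.disjoint_left]
    exact fun x hx hxX ↦ (hC' hx).2 ⟨hC'C hx, x, hxX, s.refl x⟩
  -- `C'` is a union of classes of the old partition `s`, so it survives uncrossing with respect to
  -- `s`.
  · intro E hC'E hEC hEf
    obtain ⟨E', h1, h2, h3, h4, -, h5⟩ := h.partition.exists_uncrossing h.subset h.respects
      h.finite hEC hEf
    by_contra! hlt
    have hcov := h.covered E' h1 h2 h3 (by omega)
    have := (h.partition.even_of_finitelyCovered hst.subset hC'r
      (hcov.subset (h5 C' hC'E hC'r))).2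
    exact Nat.not_even_iff_odd.2 hst.odd this

end Partition

/-! ### Hall's theorem and orientations of one level -/

/-- A consequence of Hall's theorem, applied to the doubled edges: if every set `X` of vertices is
incident with sufficiently many edges, then the edges can be partially oriented such that
every vertex `v` has at least `a v` more outgoing than incoming edges. -/
lemma exists_partial_orientation (Y : Finset α) (a : α → ℕ) (T : α → Finset β)
    [DecidableEq β] (h : ∀ X ⊆ Y, ∑ v ∈ X, (a v + (T v).card) ≤ 2 * (X.biUnion T).card) :
    ∃ O : α → Finset β, (∀ v, O v ⊆ T v) ∧ (∀ v e, e ∈ O v → v ∈ Y) ∧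
      (∀ v w e, e ∈ O v → e ∈ O w → v = w) ∧
      ∀ v ∈ Y, a v + {e ∈ (T v : Set β) | ∃ w, w ≠ v ∧ e ∈ O w}.ncard ≤ (O v).card := by
  classical
  -- Every `v` demands `a v + (T v).card` tokens, and every edge supplies two.
  let ι := Σ v : Y, Fin (a v + (T v).card)
  let t : ι → Finset (β × Bool) := fun p ↦ T p.1 ×ˢ Finset.univ
  have hall : ∀ S : Finset ι, S.card ≤ (S.biUnion t).card := by
    intro S
    let X := S.image Sigma.fst
    have h1 : S ⊆ X.sigma fun _ ↦ Finset.univ := by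
      intro p hp
      exact Finset.mem_sigma.2 ⟨Finset.mem_image_of_mem _ hp, Finset.mem_univ _⟩
    have h2 : ((X.map (Function.Embedding.subtype _)).biUnion T ×ˢ (Finset.univ : Finset Bool)) ⊆
        S.biUnion t := by
      rintro ⟨e, b⟩ he
      simp only [Finset.mem_product, Finset.mem_biUnion, Finset.mem_map, X, Finset.mem_image] at he
      obtain ⟨⟨v, ⟨w, ⟨p, hp, rfl⟩, rfl⟩, he⟩, -⟩ := he
      rw [Finset.mem_biUnion]
      exact ⟨p, hp, by simpa [t] using he⟩
    have h3 := h (X.map (Function.Embedding.subtype _)) (by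
      intro v hv
      obtain ⟨w, -, rfl⟩ := Finset.mem_map.1 hv
      exact w.2)
    rw [Finset.sum_map] at h3
    have h4 := Finset.card_le_card h1
    have h5 := Finset.card_le_card h2
    rw [Finset.card_sigma] at h4
    rw [Finset.card_product] at h5
    simp only [Finset.card_univ, Fintype.card_fin, Fintype.card_bool,
      Function.Embedding.subtype_apply] at h3 h4 h5
    omega
  obtain ⟨f, hf, hft⟩ := (Finset.all_card_le_biUnion_card_iff_exists_injective t).1 hall
  let I : Bool → α → Finset β := fun b v ↦ {e ∈ T v | ∃ p : ι, p.1.1 = v ∧ f p = (e, b)}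
  have hIT : ∀ b v, I b v ⊆ T v := fun b v ↦ Finset.filter_subset _ _
  have hII : ∀ b v w e, e ∈ I b v → e ∈ I b w → v = w := by
    intro b v w e hv hw
    obtain ⟨p, hp, hpe⟩ := (Finset.mem_filter.1 hv).2
    obtain ⟨q, hq, hqe⟩ := (Finset.mem_filter.1 hw).2
    rw [← hp, ← hq, hf (hpe.trans hqe.symm)]
  -- An edge is oriented out of `v` if both its copies go to `v`. Edges in `J`, oriented out of
  -- another vertex, give no copy to `v`; so at least `a v + (T v).card` copies are spread over at
  -- most `(T v).card - J.card` edges, and at least `a v + J.card` edges occur twice.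
  refine ⟨fun v ↦ I true v ∩ I false v, fun v ↦ Finset.inter_subset_left.trans (hIT _ _), ?_, ?_,
    ?_⟩
  · intro v e he
    obtain ⟨p, hp, -⟩ := (Finset.mem_filter.1 (Finset.mem_inter.1 he).1).2
    exact hp ▸ p.1.2
  · intro v w e hv hw
    exact hII true v w e (Finset.mem_inter.1 hv).1 (Finset.mem_inter.1 hw).1
  · intro v hv
    set J : Finset β := {e ∈ T v | ∃ w, w ≠ v ∧ e ∈ I true w ∩ I false w} with hJ
    have e1 : {e ∈ (T v : Set β) | ∃ w, w ≠ v ∧ e ∈ I true w ∩ I false w} = (J : Set β) := by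
      ext e
      simp [hJ]
    rw [e1, Set.ncard_coe_finset]
    have h1 : a v + (T v).card ≤ (I true v).card + (I false v).card := by
      let g : Fin (a v + (T v).card) → β × Bool := fun i ↦ f ⟨⟨v, hv⟩, i⟩
      have hg : Function.Injective g := by
        intro i j hij
        exact eq_of_heq (Sigma.mk.inj (hf hij)).2
      have h2 : (Finset.univ.image g) ⊆ (I true v).image (·, true) ∪ (I false v).image (·, false) := by
        intro x hx
        obtain ⟨i, -, rfl⟩ := Finset.mem_image.1 hx
        have h3 := hft ⟨⟨v, hv⟩, i⟩
        simp only [t, Finset.mem_product, Finset.mem_univ, and_true] at h3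
        rcases hgi : g i with ⟨e, b⟩
        have he : e ∈ T v := by
          have : (g i).1 ∈ T v := h3
          rwa [hgi] at this
        have hmem : e ∈ I b v := Finset.mem_filter.2 ⟨he, ⟨⟨v, hv⟩, i⟩, rfl, hgi⟩
        cases b
        · exact Finset.mem_union_right _ (Finset.mem_image_of_mem _ hmem)
        · exact Finset.mem_union_left _ (Finset.mem_image_of_mem _ hmem)
      have h3 := (Finset.card_le_card h2).trans (Finset.card_union_le _ _)
      rw [Finset.card_image_of_injective _ hg, Finset.card_univ, Fintype.card_fin] at h3
      exact h3.trans (add_le_add Finset.card_image_le Finset.card_image_le)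
    have h2 : I true v ∪ I false v ⊆ T v \ J := by
      intro e he
      rw [Finset.mem_union] at he
      refine Finset.mem_sdiff.2 ⟨he.elim (fun h ↦ hIT _ _ h) (fun h ↦ hIT _ _ h), fun heJ ↦ ?_⟩
      obtain ⟨w, hw, hew⟩ := (Finset.mem_filter.1 heJ).2
      rw [Finset.mem_inter] at hew
      rcases he with he | he
      · exact hw (hII _ _ _ _ hew.1 he)
      · exact hw (hII _ _ _ _ hew.2 he)
    have h3 := Finset.card_le_card h2
    have hJT : J ⊆ T v := Finset.filter_subset _ _
    rw [Finset.card_sdiff_of_subset hJT] at h3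
    have h4 := Finset.card_union_add_card_inter (I true v) (I false v)
    have h5 := Finset.card_le_card hJT
    change a v + J.card ≤ (I true v ∩ I false v).card
    omega

section Level

variable {G : Graph α β} {C C' : Set α}

/-- The edges that separate `Cᶜ ∪ X` from `C' ∪ (Y \ X)`. -/
def levelCut (G : Graph α β) (C C' : Set α) (Y X : Set α) : Set β :=
  G.edgesBetween (Cᶜ ∪ X) (C' ∪ (Y \ X))

/-- The endvertices in `C` of the boundary edges of `C`. -/
def innerEnds (G : Graph α β) (C : Set α) : Set α := {x ∈ C | ∃ e ∈ G.boundary C, G.Inc e x}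

lemma finite_ends_of_finite {F : Set β} (hF : F.Finite) : {x | ∃ e ∈ F, G.Inc e x}.Finite := by
  have : {x | ∃ e ∈ F, G.Inc e x} = ⋃ e ∈ F, {x | G.Inc e x} := by
    ext
    simp
  rw [this]
  refine hF.biUnion fun e _ ↦ ?_
  by_cases h : ∃ x y, G.IsLink e x y
  · obtain ⟨x, y, hxy⟩ := h
    exact (Set.toFinite {x, y}).subset fun z hz ↦ hz.eq_or_eq_of_isLink hxy
  · refine Set.finite_empty.subset fun z hz ↦ ?_
    obtain ⟨w, hw⟩ := hz
    exact h ⟨z, w, hw⟩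

lemma finite_innerEnds (hC : (G.boundary C).Finite) : (G.innerEnds C).Finite :=
  (finite_ends_of_finite hC).subset fun _ hx ↦ hx.2

lemma finite_levelCut (hG : ∀ x, (G.incidenceSet x).Finite) (hdisj : Disjoint C' (G.innerEnds C))
    (hCC : C' ⊆ C) {Y X : Set α} (hY : Y.Finite) (hXY : X ⊆ Y) :
    (G.levelCut C C' Y X).Finite := by
  refine (hY.biUnion fun x _ ↦ hG x).subset ?_
  rintro e ⟨x, hx, y, hy, hxy⟩
  simp only [Set.mem_iUnion, mem_incidenceSet]
  rcases hx with hx | hx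
  · rcases hy with hy | hy
    · exact absurd ⟨hCC hy, e, ⟨y, x, hxy.symm, hCC hy, hx⟩, hxy.inc_right⟩
        (Set.disjoint_left.1 hdisj hy)
    · exact ⟨y, hy.1, hxy.inc_right⟩
  · exact ⟨x, hXY hx, hxy.inc_left⟩

/-- A compactness argument: the linkage of `C'` to the complement of `C` is witnessed by finitely
many vertices. -/
lemma exists_finite_linked (hG : ∀ x, (G.incidenceSet x).Finite) (hCC : C' ⊆ C)
    (hC : (G.boundary C).Finite) (hdisj : Disjoint C' (G.innerEnds C))
    (hlink : ∀ E, C' ⊆ E → E ⊆ C → (G.boundary E).Finite → G.cutOrder C ≤ G.cutOrder E) :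
    ∃ Y : Finset α, (Y : Set α) ⊆ C \ C' ∧ G.innerEnds C ⊆ Y ∧
      ∀ X ⊆ Y, G.cutOrder C ≤ (G.levelCut C C' Y X).ncard := by
  classical
  by_contra! hbad
  have hI := finite_innerEnds hC
  let N : Finset α → Finset α := fun Y ↦ {y ∈ Y | y ∈ C \ C'} ∪ hI.toFinset
  have hN : ∀ Y, (N Y : Set α) ⊆ C \ C' := by
    intro Y y hy
    simp only [N, Finset.coe_union, Finset.coe_filter, Set.Finite.coe_toFinset] at hy
    rcases hy with hy | hy
    · exact hy.2
    · exact ⟨hy.1, fun hy' ↦ Set.disjoint_left.1 hdisj hy' hy⟩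
  choose X hXY hX using fun Y ↦ hbad (N Y) (hN Y) (by simp [N])
  let 𝒰 : Ultrafilter (Finset α) := Ultrafilter.of Filter.atTop
  have hU : (𝒰 : Filter (Finset α)) ≤ Filter.atTop := Ultrafilter.of_le _
  -- The limit of the counterexamples `X Y` along the ultrafilter. The set `C \ Z` lies between `C'`
  -- and `C`, so d(`C`) edges of its boundary can be selected; they lie in the level cut for some
  -- `Y`, contradicting `hX`.
  let Z : Set α := {z | ∀ᶠ Y in (𝒰 : Filter (Finset α)), z ∈ X Y}
  have hZ : Z ⊆ C \ C' := by
    intro z hz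
    obtain ⟨Y, hY⟩ := Filter.Eventually.exists hz
    exact hN Y (hXY Y hY)
  have hF : ∃ F : Finset β, ↑F ⊆ G.boundary (C \ Z) ∧ F.card = G.cutOrder C := by
    by_cases hfin : (G.boundary (C \ Z)).Finite
    · have h1 := hlink (C \ Z) (fun x hx ↦ ⟨hCC hx, fun h ↦ (hZ h).2 hx⟩) Set.sdiff_subset hfin
      rw [cutOrder, cutOrder, Set.ncard_eq_toFinset_card _ hfin] at h1
      obtain ⟨F, hF, hF'⟩ := Finset.exists_subset_card_eq h1
      exact ⟨F, fun e he ↦ by simpa using hF he, hF'⟩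
    · exact Set.Infinite.exists_subset_card_eq hfin _
  obtain ⟨F, hF, hFcard⟩ := hF
  have hev : ∀ᶠ Y in (𝒰 : Filter (Finset α)), ∀ e ∈ F, e ∈ G.levelCut C C' (N Y) (X Y) := by
    rw [Filter.eventually_all_finset]
    intro e he
    obtain ⟨x, y, hxy, ⟨hxC, hxZ⟩, hy⟩ := hF he
    have h1 : ∀ᶠ Y in (𝒰 : Filter (Finset α)), x ∈ C' ∪ (↑(N Y) \ ↑(X Y) : Set α) := by
      by_cases hx' : x ∈ C'
      · exact Filter.Eventually.of_forall fun _ ↦ Or.inl hx'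
      · have h2 : ∀ᶠ Y in (𝒰 : Filter (Finset α)), x ∉ X Y :=
          Ultrafilter.eventually_not.2 hxZ
        have h3 : ∀ᶠ Y in (𝒰 : Filter (Finset α)), x ∈ Y :=
          hU (by
            filter_upwards [Filter.eventually_ge_atTop ({x} : Finset α)] with Y hY
            exact hY (Finset.mem_singleton_self x))
        filter_upwards [h2, h3] with Y h2 h3
        refine Or.inr ⟨?_, h2⟩
        simp only [N, Finset.coe_union, Finset.coe_filter]
        exact Or.inl ⟨h3, hxC, hx'⟩
    have h2 : ∀ᶠ Y in (𝒰 : Filter (Finset α)), y ∈ Cᶜ ∪ (X Y : Set α) := by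
      by_cases hyC : y ∈ C
      · have : y ∈ Z := by
          by_contra h
          exact hy ⟨hyC, h⟩
        filter_upwards [this] with Y hY
        exact Or.inr hY
      · exact Filter.Eventually.of_forall fun _ ↦ Or.inl hyC
    filter_upwards [h1, h2] with Y h1 h2
    exact ⟨y, h2, x, h1, hxy.symm⟩
  obtain ⟨Y, hY⟩ := hev.exists
  have h1 := Set.ncard_le_ncard (s := ↑F) (fun e he ↦ hY e he)
    (finite_levelCut hG hdisj hCC (N Y).finite_toSet (by exact_mod_cast hXY Y))
  rw [Set.ncard_coe_finset, hFcard] at h1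
  exact absurd (hX Y) (not_lt.2 h1)

/-- If `C'` is linked to the complement of `C`, then some edges meeting a finite subset `Y` of
`C \ C'` can be oriented such that the edges entering `v ∈ Y` (including the boundary edges of `C`)
inject into the edges leaving `v`. -/
lemma exists_level_orientation
    (hG : ∀ x, (G.incidenceSet x).Finite) (hCC : C' ⊆ C)
    (hC : (G.boundary C).Finite) (hdisj : Disjoint C' (G.innerEnds C))
    (hlink : ∀ E, C' ⊆ E → E ⊆ C → (G.boundary E).Finite → G.cutOrder C ≤ G.cutOrder E) :
    ∃ (Y : Finset α) (O : α → Set β), (Y : Set α) ⊆ C \ C' ∧ G.innerEnds C ⊆ Y ∧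
      (∀ v e, e ∈ O v → v ∈ Y ∧ ∃ w, G.IsLink e v w ∧ w ∈ ↑Y ∪ C') ∧
      (∀ v w e, e ∈ O v → e ∈ O w → v = w) ∧
      ∀ v ∈ Y, {e | G.Inc e v ∧ (e ∈ G.boundary C ∨ ∃ w, w ≠ v ∧ e ∈ O w)}.ncard ≤
        (O v).ncard := by
  classical
  obtain ⟨Y, hYC, hIY, hY⟩ := exists_finite_linked hG hCC hC hdisj hlink
  have hTf : ∀ v, {e | ∃ w, G.IsLink e v w ∧ w ∈ ↑Y ∪ C'}.Finite := fun v ↦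
    (hG v).subset fun e ⟨w, hw, _⟩ ↦ hw.inc_left
  have hAf : ∀ v, {e | G.Inc e v ∧ e ∈ G.boundary C}.Finite := fun v ↦
    hC.subset fun e he ↦ he.2
  let T : α → Finset β := fun v ↦ (hTf v).toFinset
  let A : α → Finset β := fun v ↦ (hAf v).toFinset
  have hT : ∀ v e, e ∈ T v ↔ ∃ w, G.IsLink e v w ∧ w ∈ ↑Y ∪ C' := fun v e ↦ by simp [T]
  have hA : ∀ v e, e ∈ A v ↔ G.Inc e v ∧ e ∈ G.boundary C := fun v e ↦ by simp [A]
  have hYC' : ∀ w ∈ ↑Y ∪ C', w ∈ C := fun w hw ↦ hw.elim (fun h ↦ (hYC h).1) fun h ↦ hCC h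
  obtain ⟨O, hOT, hOY, hOO, hO⟩ := exists_partial_orientation Y (fun v ↦ (A v).card) T (by
    intro X hXY
    have hAdisj : (X : Set α).PairwiseDisjoint A := by
      intro v hv w hw hvw
      rw [Function.onFun, Finset.disjoint_left]
      intro e he he'
      rw [hA] at he he'
      obtain ⟨x, y, hxy, hx, hy⟩ := he.2
      have h1 : ∀ u ∈ X, G.Inc e u → u = x := by
        intro u hu hue
        refine (hue.eq_or_eq_of_isLink hxy).resolve_right ?_
        rintro rfl
        exact hy (hYC (hXY hu)).1
      exact hvw ((h1 v hv he.1).trans (h1 w hw he'.1).symm)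
    -- Edges with both ends in `X` are the only ones counted twice in the sum of the `(T v).card`.
    let EX : Finset β := {e ∈ X.biUnion T | ∃ x ∈ X, ∃ y ∈ X, G.IsLink e x y}
    have hEX : EX ⊆ X.biUnion T := Finset.filter_subset _ _
    have h1 : ∑ v ∈ X, (T v).card ≤ (X.biUnion T).card + EX.card := by
      have h2 : ∀ v ∈ X, T v = {e ∈ X.biUnion T | e ∈ T v} := by
        intro v hv
        ext e
        simp only [Finset.mem_filter, Finset.mem_biUnion]
        exact ⟨fun h ↦ ⟨⟨v, hv, h⟩, h⟩, And.right⟩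
      have h3 := Finset.sum_card_bipartiteAbove_eq_sum_card_bipartiteBelow (s := X)
        (t := X.biUnion T) (fun v e ↦ e ∈ T v)
      calc ∑ v ∈ X, (T v).card = ∑ v ∈ X, ({e ∈ X.biUnion T | e ∈ T v} : Finset β).card :=
            Finset.sum_congr rfl fun v hv ↦ congrArg _ (h2 v hv)
        _ = ∑ e ∈ X.biUnion T, ({v ∈ X | e ∈ T v} : Finset α).card := h3
        _ ≤ ∑ e ∈ X.biUnion T, (1 + if e ∈ EX then 1 else 0) := by
            refine Finset.sum_le_sum fun e he ↦ ?_
            obtain ⟨v, hv, hev⟩ := Finset.mem_biUnion.1 he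
            obtain ⟨w, hvw, hw⟩ := (hT v e).1 hev
            have h4 : ({v ∈ X | e ∈ T v} : Finset α) ⊆ {v, w} := by
              intro u hu
              obtain ⟨z, huz, -⟩ := (hT u e).1 (Finset.mem_filter.1 hu).2
              simpa using huz.inc_left.eq_or_eq_of_isLink hvw
            split_ifs with h5
            · exact (Finset.card_le_card h4).trans Finset.card_le_two
            · refine (Finset.card_le_card (t := {v}) fun u hu ↦ ?_).trans
                (Finset.card_singleton v).le
              have hu' := h4 hu
              rw [Finset.mem_insert, Finset.mem_singleton] at hu'
              rw [Finset.mem_singleton]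
              refine hu'.resolve_right ?_
              rintro rfl
              exact h5 (Finset.mem_filter.2 ⟨he, v, hv, u, (Finset.mem_filter.1 hu).1, hvw⟩)
        _ = (X.biUnion T).card + EX.card := by
            rw [Finset.sum_add_distrib, Finset.sum_const, smul_eq_mul, mul_one,
              Finset.sum_ite_mem, Finset.inter_eq_right.2 hEX, Finset.sum_const, smul_eq_mul,
              mul_one]
    have hAC : X.biUnion A ⊆ hC.toFinset := by
      intro e he
      obtain ⟨v, -, hv⟩ := Finset.mem_biUnion.1 he
      simpa using ((hA v e).1 hv).2
    -- Since the level cut has at least d(`C`) edges, this inclusion gives ∑ |`A v`| + |`EX`| ≤ |⋃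
    -- `T v`|, which combines with `h1` to Hall's condition.
    have h2 : G.levelCut C C' Y X ⊆
        ↑((hC.toFinset \ X.biUnion A) ∪ (X.biUnion T \ EX)) := by
      rintro e ⟨x, hx, y, hy, hxy⟩
      have hyC : y ∈ C := hYC' y (hy.elim Or.inr fun h ↦ Or.inl h.1)
      have hyX : y ∉ X := fun h ↦ hy.elim (hYC (hXY h)).2 fun h' ↦ h'.2 h
      rw [Finset.mem_coe, Finset.mem_union, Finset.mem_sdiff, Finset.mem_sdiff]
      by_cases hxX : x ∈ X
      · right
        refine ⟨Finset.mem_biUnion.2 ⟨x, hxX, (hT x e).2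
          ⟨y, hxy, hy.elim Or.inr fun h ↦ Or.inl h.1⟩⟩, fun h ↦ ?_⟩
        obtain ⟨u, hu, w, hw, huw⟩ := (Finset.mem_filter.1 h).2
        rcases hxy.inc_right.eq_or_eq_of_isLink huw with rfl | rfl
        · exact hyX hu
        · exact hyX hw
      · left
        have hxC : x ∉ C := hx.resolve_right hxX
        refine ⟨by simpa using ⟨y, x, hxy.symm, hyC, hxC⟩, fun h ↦ ?_⟩
        obtain ⟨u, hu, hue⟩ := Finset.mem_biUnion.1 h
        rcases ((hA u e).1 hue).1.eq_or_eq_of_isLink hxy with rfl | rfl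
        · exact hxX hu
        · exact hyX hu
    have h3 := (hY X hXY).trans (Set.ncard_le_ncard h2 (Finset.finite_toSet _))
    rw [Set.ncard_coe_finset] at h3
    have h4 := h3.trans (Finset.card_union_le _ _)
    rw [Finset.card_sdiff_of_subset hAC, Finset.card_sdiff_of_subset hEX,
      Finset.card_biUnion hAdisj, cutOrder, Set.ncard_eq_toFinset_card _ hC] at h4
    have h5 := Finset.card_le_card hAC
    rw [Finset.card_biUnion hAdisj] at h5
    have h6 := Finset.card_le_card hEX
    rw [Finset.sum_add_distrib]
    omega)
  refine ⟨Y, fun v ↦ O v, hYC, hIY, fun v e he ↦ ⟨hOY v e he, (hT v e).1 (hOT v he)⟩,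
    fun v w e hv hw ↦ hOO v w e hv hw, fun v hv ↦ ?_⟩
  rw [Set.ncard_coe_finset]
  refine le_trans ?_ (hO v hv)
  rw [← Set.ncard_coe_finset]
  refine le_trans (Set.ncard_le_ncard ?_ ((A v).finite_toSet.union
    ((T v).finite_toSet.subset (Set.sep_subset _ _)))) (Set.ncard_union_le _ _)
  rintro e ⟨hev, he | ⟨w, hwv, hew⟩⟩
  · exact Or.inl ((hA v e).2 ⟨hev, he⟩)
  · obtain ⟨z, hwz, hz⟩ := (hT w e).1 (hOT w hew)
    have hvz : v = z := (hev.eq_or_eq_of_isLink hwz).resolve_left (Ne.symm hwv)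
    exact Or.inr ⟨(hT v e).2 ⟨w, hvz ▸ hwz.symm, Or.inl (hOY w e hew)⟩, w, hwv, hew⟩

end Level

/-! ### Rays through a linked sequence -/

/-- A one-way infinite walk that visits each vertex finitely often contains a ray. -/
lemma exists_ray_of_walk {G : Graph α β} (u : ℕ → α) (e : ℕ → β)
    (hlink : ∀ i, G.IsLink (e i) (u i) (u (i + 1))) (hfin : ∀ x, {i | u i = x}.Finite) :
    ∃ (R : G.Ray) (t : ℕ → ℕ), StrictMono t ∧ (∀ i, R.vertex i = u (t i)) ∧
      (∀ i, R.edge i = e (t i)) ∧ R.vertex 0 = u 0 := by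
  -- Loop erasure by last visits: step on from the last visit to a vertex, then jump to the last
  -- visit to the vertex reached.
  have hlast : ∀ i, ∃ l, u l = u i ∧ ∀ j, u j = u i → j ≤ l := by
    intro i
    obtain ⟨l, hl, hl'⟩ := Set.exists_max_image {j | u j = u i} id (hfin _) ⟨i, rfl⟩
    exact ⟨l, hl, hl'⟩
  choose l hl hl' using hlast
  let t : ℕ → ℕ := fun n ↦ Nat.rec (l 0) (fun _ k ↦ l (k + 1)) n
  have ht : ∀ n, t (n + 1) = l (t n + 1) := fun n ↦ rfl
  have hmono : StrictMono t := strictMono_nat_of_lt_succ fun n ↦ by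
    rw [ht]
    exact Nat.lt_of_succ_le (hl' (t n + 1) (t n + 1) rfl)
  have htl : ∀ n j, u j = u (t n) → j ≤ t n := by
    intro n j hj
    cases n with
    | zero => exact hl' 0 j (hj.trans (hl 0))
    | succ n => exact hl' (t n + 1) j (hj.trans (hl (t n + 1)))
  refine ⟨⟨fun i ↦ u (t i), fun i ↦ e (t i), fun i ↦ ?_, fun i j hij ↦ ?_⟩, t, hmono,
    fun _ ↦ rfl, fun _ ↦ rfl, hl 0⟩
  · rw [ht, hl]
    exact hlink (t i)
  · exact hmono.injective (le_antisymm (htl j (t i) hij) (htl i (t j) hij.symm))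

/-- A decreasing sequence of vertex sets with finite boundaries such that no set between `C (n + 1)`
and `C n` has a smaller cut order than `C n`. -/
structure IsLinkedSequence (G : Graph α β) (C : ℕ → Set α) : Prop where
  anti : ∀ n, C (n + 1) ⊆ C n
  finite : ∀ n, (G.boundary (C n)).Finite
  disjoint : ∀ n, Disjoint (C (n + 1)) (G.innerEnds (C n))
  linked : ∀ n E, C (n + 1) ⊆ E → E ⊆ C n → (G.boundary E).Finite →
    G.cutOrder (C n) ≤ G.cutOrder E

section LinkedSequence

variable {G : Graph α β} {C : ℕ → Set α}

/-- A set of directed edges (pairs of an edge and its head), closed under an injective successor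
function, that runs through the sets of the sequence. -/
lemma IsLinkedSequence.exists_successor (hC : G.IsLinkedSequence C)
    (hloop : ∀ e x, ¬G.IsLink e x x)
    (hG : ∀ x, (G.incidenceSet x).Finite) :
    ∃ (Y : ℕ → Finset α) (P : Set (β × α)) (next : β × α → β × α),
      (∀ n, (Y n : Set α) ⊆ C n) ∧ (∀ p ∈ P, ∃ n, p.2 ∈ Y n) ∧
      (∀ n e x, e ∈ G.boundary (C n) → G.Inc e x → x ∈ C n → (e, x) ∈ P) ∧
      (∀ p ∈ P, next p ∈ P) ∧ (∀ p ∈ P, G.IsLink (next p).1 p.2 (next p).2) ∧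
      (∀ p ∈ P, ∀ n, p.2 ∈ C n → (next p).2 ∈ C n) ∧
      (∀ p ∈ P, ∀ q ∈ P, (next p).1 = (next q).1 → p = q) := by
  classical
  have hanti : Antitone C := antitone_nat_of_succ_le hC.anti
  choose Y O hYC hIY hO hOO hcard using fun n ↦ exists_level_orientation hG (hC.anti n)
    (hC.finite n) (hC.disjoint n) (hC.linked n)
  have hlevel : ∀ m n v, v ∈ Y m → v ∈ Y n → m = n := by
    have key : ∀ m n v, v ∈ Y m → v ∈ Y n → ¬m < n := fun m n v hm hn hlt ↦
      (hYC m hm).2 (hanti (Nat.succ_le_of_lt hlt) (hYC n hn).1)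
    intro m n v hm hn
    have h1 := key m n v hm hn
    have h2 := key n m v hn hm
    omega
  let I : ℕ → α → Set β := fun n v ↦
    {e | G.Inc e v ∧ (e ∈ G.boundary (C n) ∨ ∃ w, w ≠ v ∧ e ∈ O n w)}
  have hIf : ∀ n v, (I n v).Finite := fun n v ↦ (hG v).subset fun e he ↦ he.1
  have hOf : ∀ n v, (O n v).Finite := fun n v ↦ (hG v).subset fun e he ↦ by
    obtain ⟨-, w, hw, -⟩ := hO n v e he
    exact hw.inc_left
  have hinj : ∀ n v, ∃ f : β → β, v ∈ Y n → Set.MapsTo f (I n v) (O n v) ∧ Set.InjOn f (I n v) := by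
    intro n v
    by_cases hv : v ∈ Y n
    · rcases (I n v).eq_empty_or_nonempty with h | ⟨b, -⟩
      · exact ⟨id, fun _ ↦ by rw [h]; exact ⟨Set.mapsTo_empty _ _, Set.injOn_empty _⟩⟩
      · have : Nonempty β := ⟨b⟩
        have h := hcard n v hv
        have h' : (I n v).encard ≤ (O n v).encard := by
          rw [← (hIf n v).cast_ncard_eq, ← (hOf n v).cast_ncard_eq]
          exact_mod_cast h
        obtain ⟨f, hf, hf'⟩ := (hIf n v).exists_injOn_of_encard_le h'
        exact ⟨f, fun _ ↦ ⟨hf, hf'⟩⟩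
    · exact ⟨id, fun h ↦ absurd h hv⟩
  choose f hf using hinj
  let P : Set (β × α) := {p | ∃ n, p.2 ∈ Y n ∧ p.1 ∈ I n p.2}
  have hnext : ∀ p : β × α, ∃ q : β × α, p ∈ P → ∃ n, p.2 ∈ Y n ∧ p.1 ∈ I n p.2 ∧
      q.1 = f n p.2 p.1 ∧ q.1 ∈ O n p.2 ∧ G.IsLink q.1 p.2 q.2 ∧ q.2 ∈ ↑(Y n) ∪ C (n + 1) := by
    intro p
    by_cases hp : p ∈ P
    · obtain ⟨n, hn, hpI⟩ := hp
      have h1 := (hf n p.2 hn).1 hpI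
      obtain ⟨-, w, hw, hw'⟩ := hO n _ _ h1
      exact ⟨(f n p.2 p.1, w), fun _ ↦ ⟨n, hn, hpI, rfl, h1, hw, hw'⟩⟩
    · exact ⟨p, fun h ↦ absurd h hp⟩
  choose next hnext using hnext
  have hboundary : ∀ n e x, e ∈ G.boundary (C n) → G.Inc e x → x ∈ C n → (e, x) ∈ P :=
    fun n e x he hex hx ↦ ⟨n, hIY n ⟨hx, e, he, hex⟩, hex, Or.inl he⟩
  -- For `m < n`, an edge of `O m v` has its end `v` outside `C (m + 1)`, whereas both ends of an
  -- edge of `O n w` lie in `C n ⊆ C (m + 1)`.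
  have hcross : ∀ m n v w e, v ∈ Y m → w ∈ Y n → e ∈ O m v → e ∈ O n w → ¬m < n := by
    intro m n v w e hv hw hev hew hlt
    have h1 := hYC m hv
    have h2 := hanti (Nat.succ_le_of_lt hlt)
    obtain ⟨-, z, hz, hz'⟩ := hO n w e hew
    obtain ⟨-, y, hy, -⟩ := hO m v e hev
    rcases hy.inc_left.eq_or_eq_of_isLink hz with rfl | rfl
    · exact h1.2 (h2 (hYC n hw).1)
    · exact h1.2 (h2 (hz'.elim (fun h ↦ (hYC n h).1) fun h ↦ hC.anti n h))
  refine ⟨Y, P, next, fun n v hv ↦ (hYC n hv).1, fun p ⟨n, hn, _⟩ ↦ ⟨n, hn⟩, hboundary,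
    fun p hp ↦ ?_, fun p hp ↦ ?_, fun p hp m hm ↦ ?_, fun p hp q hq hpq ↦ ?_⟩
  · obtain ⟨n, hn, -, -, h1, h2, h3⟩ := hnext p hp
    rcases h3 with h3 | h3
    · refine ⟨n, h3, h2.inc_right, Or.inr ⟨p.2, fun h ↦ ?_, h1⟩⟩
      rw [h] at h2
      exact hloop _ _ h2
    · refine hboundary (n + 1) _ _ ?_ h2.inc_right h3
      exact ⟨_, _, h2.symm, h3, (hYC n hn).2⟩
  · obtain ⟨n, -, -, -, -, h, -⟩ := hnext p hp
    exact h
  · obtain ⟨n, hn, -, -, -, -, h⟩ := hnext p hp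
    have hmn : m ≤ n := by
      by_contra hlt
      exact (hYC n hn).2 (hanti (Nat.succ_le_of_lt (not_le.1 hlt)) hm)
    exact hanti hmn (h.elim (fun h ↦ (hYC n h).1) fun h ↦ hC.anti n h)
  · obtain ⟨n, hn, hpI, h1, h2, -⟩ := hnext p hp
    obtain ⟨m, hm, hqI, h1', h2', -⟩ := hnext q hq
    rw [← hpq] at h1' h2'
    have hnm : n = m := by
      have h3 := hcross n m _ _ _ hn hm h2 h2'
      have h4 := hcross m n _ _ _ hm hn h2' h2
      omega
    subst hnm
    have hv := hOO n _ _ _ h2 h2'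
    rw [← hv] at h1' hqI
    exact Prod.ext ((hf n p.2 hn).2 hpI hqI (h1.symm.trans h1')) hv

/-- From the boundary of each set of a linked sequence, as many edge-disjoint rays as it has edges
run through the sequence. -/
lemma IsLinkedSequence.exists_rays (hC : G.IsLinkedSequence C) (hloop : ∀ e x, ¬G.IsLink e x x)
    (hG : ∀ x, (G.incidenceSet x).Finite) (n : ℕ) :
    ∃ R : Fin (G.cutOrder (C n)) → G.Ray,
      (∀ i, (R i).vertex 0 ∉ C n ∧ (∃ e ∈ G.boundary (C n), G.Inc e ((R i).vertex 0)) ∧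
        (∀ k, (R i).vertex (k + 1) ∈ C n) ∧ ∀ m, (R i).HasTailIn (C m)) ∧
      ∀ i j, i ≠ j → Disjoint (R i).edges (R j).edges := by
  classical
  have hanti : Antitone C := antitone_nat_of_succ_le hC.anti
  obtain ⟨Y, P, next, hYC, hPY, hP, hnP, hlink, hstay, hinj⟩ := hC.exists_successor hloop hG
  have hiter : ∀ p ∈ P, ∀ i, next^[i] p ∈ P := by
    intro p hp i
    induction i with
    | zero => exact hp
    | succ i ih =>
      rw [Function.iterate_succ_apply']
      exact hnP _ ih
  have hiterC : ∀ p ∈ P, p.2 ∈ C n → ∀ i, (next^[i] p).2 ∈ C n := by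
    intro p hp hpn i
    induction i with
    | zero => exact hpn
    | succ i ih =>
      rw [Function.iterate_succ_apply']
      exact hstay _ (hiter p hp i) n ih
  have hnot : ∀ p ∈ P, p.2 ∈ C n → ∀ i, (next^[i + 1] p).1 ∉ G.boundary (C n) := by
    intro p hp hpn i h
    rw [Function.iterate_succ_apply', (hlink _ (hiter p hp i)).mem_boundary_iff] at h
    have h1 := hiterC p hp hpn i
    exact h ⟨fun _ ↦ hstay _ (hiter p hp i) n h1, fun _ ↦ h1⟩
  -- Coinciding edges can be traced back through the injective successor. Both traces reach their
  -- start together, because no later edge lies in the boundary of `C n`.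
  have hdist : ∀ p ∈ P, ∀ q ∈ P, p.2 ∈ C n → q.2 ∈ C n → p.1 ∈ G.boundary (C n) →
      q.1 ∈ G.boundary (C n) → ∀ i j, (next^[i] p).1 = (next^[j] q).1 → p.1 = q.1 ∧ i = j := by
    intro p hp q hq hpn hqn hpb hqb i
    induction i with
    | zero =>
      intro j h
      cases j with
      | zero => exact ⟨h, rfl⟩
      | succ j =>
        have h' : p.1 = (next^[j + 1] q).1 := h
        exact absurd (h' ▸ hpb) (hnot q hq hqn j)
    | succ i ih =>
      intro j h
      cases j with
      | zero =>
        have h' : (next^[i + 1] p).1 = q.1 := h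
        exact absurd (h' ▸ hqb) (hnot p hp hpn i)
      | succ j =>
        rw [Function.iterate_succ_apply', Function.iterate_succ_apply'] at h
        obtain ⟨h1, h2⟩ := ih j (congrArg Prod.fst (hinj _ (hiter p hp i) _ (hiter q hq j) h))
        exact ⟨h1, congrArg (· + 1) h2⟩
  have hray : ∀ e ∈ G.boundary (C n), ∃ R : G.Ray, ∃ p ∈ P, p.1 = e ∧ p.2 ∈ C n ∧
      R.vertex 0 ∉ C n ∧ G.Inc e (R.vertex 0) ∧ (∀ k, R.vertex (k + 1) ∈ C n) ∧
      (∀ m, R.HasTailIn (C m)) ∧ ∀ k, ∃ i, R.edge k = (next^[i] p).1 := by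
    intro e he
    obtain ⟨x, y, hxy, hx, hy⟩ := id he
    have hp := hP n e x he hxy.inc_left hx
    let d : ℕ → β × α := fun i ↦ next^[i] (e, x)
    let u : ℕ → α := fun i ↦ Nat.casesOn i y fun i ↦ (d i).2
    have hul : ∀ i, G.IsLink (d i).1 (u i) (u (i + 1)) := by
      intro i
      cases i with
      | zero => exact hxy.symm
      | succ i =>
        have := hlink _ (hiter _ hp i)
        rwa [← Function.iterate_succ_apply' next i] at this
    have hdinj : Function.Injective fun i ↦ (d i).1 := fun i j hij ↦
      (hdist _ hp _ hp hx hx he he i j hij).2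
    have hufin : ∀ z, {i | u i = z}.Finite := by
      intro z
      -- The edges of the walk are distinct, and only finitely many are incident with `z`.
      refine ((hG z).preimage hdinj.injOn).subset ?_
      rintro i rfl
      exact (hul i).inc_left
    obtain ⟨R, t, ht, hRv, hRe, hR0⟩ := exists_ray_of_walk u (fun i ↦ (d i).1) hul hufin
    refine ⟨R, (e, x), hp, rfl, hx, ?_, ?_, ?_, ?_, fun k ↦ ⟨t k, hRe k⟩⟩
    · rw [hR0]
      exact hy
    · rw [hR0]
      exact hxy.inc_right
    · intro k
      rw [hRv]
      have : 0 < t (k + 1) := (Nat.zero_le _).trans_lt (ht (Nat.succ_pos k))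
      obtain ⟨i, hi⟩ := Nat.exists_eq_succ_of_ne_zero this.ne'
      rw [hi]
      exact hiterC _ hp hx i
    · intro m
      -- Apart from the start, every vertex of the walk outside `C m` lies in one of the finite sets
      -- `Y j` with `j < m`.
      have hfin : {i | u i ∉ C m}.Finite := by
        have : {i | u i ∉ C m} ⊆ {0} ∪ ⋃ j ∈ Finset.range m, ⋃ z ∈ Y j, {i | u i = z} := by
          intro i hi
          cases i with
          | zero => exact Or.inl rfl
          | succ i =>
            right
            obtain ⟨j, hj⟩ := hPY _ (hiter _ hp i)
            simp only [Set.mem_iUnion, Finset.mem_range]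
            refine ⟨j, ?_, _, hj, rfl⟩
            by_contra hjm
            exact hi (hanti (not_lt.1 hjm) (hYC j hj))
        refine Set.Finite.subset ((Set.finite_singleton 0).union ?_) this
        exact (Finset.range m).finite_toSet.biUnion fun j _ ↦
          (Y j).finite_toSet.biUnion fun z _ ↦ hufin z
      obtain ⟨N, hN⟩ := hfin.bddAbove
      refine ⟨N + 1, fun k hk ↦ ?_⟩
      rw [hRv]
      by_contra h
      have h1 : t k ≤ N := hN h
      have h2 := ht.le_apply (x := k)
      omega
  choose R p hpP hpe hpC hR0 hRinc hRC hRtail hRe using hray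
  have := (hC.finite n).to_subtype
  let b : Fin (G.cutOrder (C n)) ≃ G.boundary (C n) :=
    (Finite.equivFinOfCardEq (α := G.boundary (C n)) rfl).symm
  refine ⟨fun i ↦ R (b i) (b i).2, fun i ↦ ⟨hR0 _ _, ⟨b i, (b i).2, hRinc _ _⟩, hRC _ _,
    hRtail _ _⟩, fun i j hij ↦ ?_⟩
  rw [Set.disjoint_left]
  rintro _ ⟨k, rfl⟩ ⟨l, hl⟩
  obtain ⟨i', hi'⟩ := hRe (b i) (b i).2 k
  obtain ⟨j', hj'⟩ := hRe (b j) (b j).2 l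
  have h := (hdist _ (hpP (b i) (b i).2) _ (hpP (b j) (b j).2) (hpC _ _) (hpC _ _)
    (by rw [hpe]; exact (b i).2) (by rw [hpe]; exact (b j).2) i' j'
    (by rw [← hi', ← hj', hl])).1
  rw [hpe, hpe] at h
  exact hij (b.injective (Subtype.ext h))

end LinkedSequence

/-! ### The end to which a linked sequence converges -/

section Ends

variable {G : Graph α β} {C : ℕ → Set α} {D S : Set α}

lemma IsConnectedSet.sameComponent_deleteVerts (hD : G.IsConnectedSet D) (hDS : Disjoint D S)
    {x y : α} (hx : x ∈ D) (hy : y ∈ D) (hxV : x ∈ V(G)) :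
    (G.deleteVerts S).SameComponent x y := by
  have hS := Set.disjoint_left.1 hDS
  refine ⟨by simpa using ⟨hxV, hS hx⟩, ?_⟩
  by_contra hxy
  obtain ⟨e, a, b, hab, ha, hb⟩ := hD {z | Relation.ReflTransGen (G.deleteVerts S).Adj x z}
    ⟨x, hx, .refl⟩ ⟨y, hy, hxy⟩
  refine hb.2 (Relation.ReflTransGen.tail ha.2 ⟨e, ?_⟩)
  rw [deleteVerts_isLink]
  exact ⟨hab, hS ha.1, hS hb.1⟩

lemma Ray.Equivalent.hasTailIn {R R' : G.Ray} (h : R.Equivalent R')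
    (hD : (G.boundary D).Finite) (hR : R.HasTailIn D) : R'.HasTailIn D := by
  -- Deleting the outer endvertices of the boundary separates `D` from everything else.
  let S : Set α := {x | ∃ e ∈ G.boundary D, G.Inc e x} \ D
  obtain ⟨N, hN⟩ := h S ((finite_ends_of_finite hD).subset Set.sdiff_subset)
    fun x hx ↦ by
      obtain ⟨e, -, he⟩ := hx.1
      exact he.vertex_mem
  obtain ⟨M, hM⟩ := hR
  refine ⟨N, fun n hn ↦ ?_⟩
  obtain ⟨-, h1⟩ := hN (max M N) n (le_max_right _ _) hn
  generalize R'.vertex n = z at h1 ⊢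
  induction h1 with
  | refl => exact hM _ (le_max_left _ _)
  | @tail a b _ hab ih =>
    obtain ⟨e, he⟩ := hab
    rw [deleteVerts_isLink] at he
    by_contra hb
    exact he.2.2 ⟨⟨e, ⟨a, b, he.1, ih, hb⟩, he.1.inc_right⟩, hb⟩

lemma Ray.equivalent_of_hasTailIn (hconn : ∀ n, G.IsConnectedSet (C n))
    (hC : ∀ S : Set α, S.Finite → ∃ n, Disjoint (C n) S) {R R' : G.Ray}
    (hR : ∀ n, R.HasTailIn (C n)) (hR' : ∀ n, R'.HasTailIn (C n)) : R.Equivalent R' := by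
  intro S hS _
  obtain ⟨n, hn⟩ := hC S hS
  obtain ⟨N, hN⟩ := hR n
  obtain ⟨N', hN'⟩ := hR' n
  exact ⟨max N N', fun i j hi hj ↦ (hconn n).sameComponent_deleteVerts hn (hN i (by omega))
    (hN' j (by omega)) (R.isLink i).left_mem⟩

/-- Edge-disjoint rays that start outside `D` and have tails in `D` use distinct boundary edges. -/
lemma card_le_cutOrder_of_disjoint_rays (hD : (G.boundary D).Finite) {k : ℕ} (R : Fin k → G.Ray)
    (h0 : ∀ i, (R i).vertex 0 ∉ D) (htail : ∀ i, (R i).HasTailIn D)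
    (hdisj : ∀ i j, i ≠ j → Disjoint (R i).edges (R j).edges) : k ≤ G.cutOrder D := by
  have hcross : ∀ i, ∃ n, (R i).edge n ∈ G.boundary D := by
    intro i
    by_contra! h
    obtain ⟨N, hN⟩ := htail i
    have : ∀ n, (R i).vertex n ∉ D := by
      intro n
      induction n with
      | zero => exact h0 i
      | succ n ih =>
        have := h n
        rw [((R i).isLink n).mem_boundary_iff] at this
        tauto
    exact this N (hN N le_rfl)
  choose n hn using hcross
  have hinj : Function.Injective fun i ↦ (R i).edge (n i) := by
    intro i j hij
    by_contra hne
    exact Set.disjoint_left.1 (hdisj i j hne) ⟨n i, rfl⟩ ⟨n j, hij.symm⟩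
  have h1 : Set.range (fun i ↦ (R i).edge (n i)) ⊆ G.boundary D := by
    rintro _ ⟨i, rfl⟩
    exact hn i
  have h2 := Set.ncard_le_ncard h1 hD
  rwa [Set.ncard_range_of_injective hinj, Nat.card_fin] at h2

/-- The sets have empty intersection: otherwise connectedness of `C 0` yields an edge from a vertex
outside some `C n` to a vertex `v` in all of them, but then `v` is an inner end of `C n` and is
missing from `C (n + 1)`. -/
lemma IsLinkedSequence.exists_disjoint (hC : G.IsLinkedSequence C)
    (hconn : G.IsConnectedSet (C 0)) (hne : (G.boundary (C 0)).Nonempty)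
    (hS : S.Finite) : ∃ n, Disjoint (C n) S := by
  have hanti : Antitone C := antitone_nat_of_succ_le hC.anti
  have hempty : ∀ x, ∃ n, x ∉ C n := by
    by_contra! h
    obtain ⟨x, hx⟩ := h
    obtain ⟨e, a, b, hab, ha, hb⟩ := hne
    obtain ⟨f, u, v, huv, hu, hv⟩ := hconn {z | ∃ n, z ∉ C n}
      ⟨a, ha, 1, fun h ↦ Set.disjoint_left.1 (hC.disjoint 0) h
        ⟨ha, e, ⟨a, b, hab, ha, hb⟩, hab.inc_left⟩⟩ ⟨x, hx 0, fun ⟨n, hn⟩ ↦ hn (hx n)⟩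
    obtain ⟨n, hn⟩ := hu.2
    have hvn : ∀ m, v ∈ C m := fun m ↦ by
      by_contra h
      exact hv.2 ⟨m, h⟩
    exact Set.disjoint_left.1 (hC.disjoint n) (hvn (n + 1))
      ⟨hvn n, f, ⟨v, u, huv.symm, hvn n, hn⟩, huv.inc_right⟩
  choose n hn using hempty
  obtain ⟨N, hN⟩ := (hS.image n).bddAbove
  refine ⟨N, Set.disjoint_left.2 fun x hx hxS ↦ hn x (hanti (hN ⟨x, hxS, rfl⟩) hx)⟩

/-- A linked sequence of connected sets with odd boundaries converges to an end that is not even. -/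
lemma IsLinkedSequence.exists_not_isEvenEnd (hC : G.IsLinkedSequence C)
    (hconn : ∀ n, G.IsConnectedSet (C n)) (hodd : ∀ n, Odd (G.cutOrder (C n)))
    (hloop : ∀ e x, ¬G.IsLink e x x) (hG : ∀ x, (G.incidenceSet x).Finite) :
    ∃ R : G.Ray, R.HasTailIn (C 0) ∧ ¬G.IsEvenEnd R.toEnd := by
  have hne : (G.boundary (C 0)).Nonempty := (Set.ncard_pos (hC.finite 0)).1 (hodd 0).pos
  have hconv : ∀ S : Set α, S.Finite → ∃ n, Disjoint (C n) S := fun S hS ↦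
    hC.exists_disjoint (hconn 0) hne hS
  obtain ⟨R₀, hR₀, -⟩ := hC.exists_rays hloop hG 0
  let R : G.Ray := R₀ ⟨0, (hodd 0).pos⟩
  have hR : ∀ m, R.HasTailIn (C m) := (hR₀ _).2.2.2
  refine ⟨R, hR 0, ?_⟩
  rintro ⟨S, hS, hSV, hmax⟩
  obtain ⟨n, hn⟩ := hconv S hS
  -- The outer ends of the boundary of `C n` serve as first vertices of the constructed rays. As
  -- `S'` avoids `C n`, every ray of this end starting in `S'` crosses that boundary.
  let S' : Set α := S ∪ {x | ∃ e ∈ G.boundary (C n), G.Inc e x} \ C n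
  have hS'C : ∀ x ∈ S', x ∉ C n := by
    rintro x (hx | hx) hxC
    · exact Set.disjoint_left.1 hn hxC hx
    · exact hx.2 hxC
  obtain ⟨k, ⟨hk, hk'⟩, heven⟩ := hmax S'
    (hS.union ((finite_ends_of_finite (hC.finite n)).subset Set.sdiff_subset))
    (Set.union_subset hSV fun x hx ↦ by
      obtain ⟨e, -, he⟩ := hx.1
      exact he.vertex_mem) Set.subset_union_left
  obtain ⟨Q, hQ, hQdisj⟩ := hC.exists_rays hloop hG n
  have h1 : G.cutOrder (C n) ≤ k := by
    refine hk' ⟨Q, fun i ↦ ⟨?_, Or.inr ⟨(hQ i).2.1, (hQ i).1⟩, fun m hm ↦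
      hS'C _ hm ((hQ i).2.2.1 m)⟩, hQdisj⟩
    exact Quotient.sound (Ray.equivalent_of_hasTailIn hconn hconv (hQ i).2.2.2 hR)
  obtain ⟨Q', hQ', hQ'disj⟩ := hk
  have h2 : k ≤ G.cutOrder (C n) := by
    refine card_le_cutOrder_of_disjoint_rays (hC.finite n) Q' (fun i ↦ hS'C _ (hQ' i).2.1)
      (fun i ↦ ?_) hQ'disj
    have h : (Q' i).Equivalent R := Quotient.exact (hQ' i).1
    exact ((raySetoid G).symm h).hasTailIn (hC.finite n) (hR n)
  rw [le_antisymm h2 h1] at heven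
  exact Nat.not_even_iff_odd.2 (hodd n) heven

end Ends

/-! ### Construction of the sequence and conclusion -/

lemma isEvenPartition_bot {G : Graph α β} {B : Set α}
    (hfin : ∀ x ∈ B, (G.boundary {x}).Finite) (heven : ∀ x ∈ B, Even (G.cutOrder {x})) :
    G.IsEvenPartition B ⊥ := by
  have hb : ∀ x : α, block ⊥ x = {x} := by
    intro x
    ext y
    exact eq_comm
  refine ⟨?_, ?_, ?_, ?_, ?_⟩ <;> intro x hx <;> rw [hb]
  · exact Set.singleton_subset_iff.2 hx
  · exact isConnectedSet_singleton x
  · exact hfin x hx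
  · exact heven x hx
  · intro E _
    by_cases hxE : x ∈ E
    · left
      rw [Set.inter_eq_left.2 (Set.singleton_subset_iff.2 hxE)]
    · right
      rw [sdiff_eq_left.2 (Set.disjoint_singleton_left.2 hxE)]

/-- If all vertices of a set with a finite odd boundary are even, then it contains a tail of a ray
of an end that is not even. -/
lemma exists_not_isEvenEnd_of_odd {G : Graph α β} {B : Set α} (hloop : ∀ e x, ¬G.IsLink e x x)
    (hG : ∀ x, (G.incidenceSet x).Finite) (hfin : (G.boundary B).Finite)
    (hodd : Odd (G.cutOrder B)) (heven : ∀ x ∈ B, Even (G.incidenceSet x).ncard) :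
    ∃ R : G.Ray, R.HasTailIn B ∧ ¬G.IsEvenEnd R.toEnd := by
  have hsingle : ∀ x, G.boundary {x} = G.incidenceSet x := by
    intro x
    ext e
    constructor
    · rintro ⟨a, b, hab, rfl, -⟩
      exact hab.inc_left
    · rintro ⟨y, hy⟩
      refine ⟨x, y, hy, rfl, ?_⟩
      rintro rfl
      exact hloop _ _ hy
  have hbot : G.IsEvenPartition B ⊥ := isEvenPartition_bot (fun x _ ↦ hsingle x ▸ hG x)
    fun x hx ↦ by
      rw [cutOrder, hsingle]
      exact heven x hx
  obtain ⟨s₀, C₀, -, -, h₀⟩ := hbot.exists_stage_subset subset_rfl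
    (fun x y hxy hx ↦ (show x = y from hxy) ▸ hx) hfin hodd
  -- The sequence is obtained by iterating `exists_next`, each time with the inner ends of the
  -- current set as the finite set to avoid.
  let Stage := {p : Setoid α × Set α // G.IsOddStage B p.1 p.2}
  have hstep : ∀ p : Stage, ∃ q : Stage, q.1.2 ⊆ p.1.2 ∧ Disjoint q.1.2 (G.innerEnds p.1.2) ∧
      ∀ E, q.1.2 ⊆ E → E ⊆ p.1.2 → (G.boundary E).Finite →
        G.cutOrder p.1.2 ≤ G.cutOrder E := by
    intro p
    obtain ⟨s', C', h1, h2, h3, h4⟩ := p.2.exists_next (finite_innerEnds p.2.finite)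
    exact ⟨⟨(s', C'), h3⟩, h1, h2, h4⟩
  choose step hstep using hstep
  let C : ℕ → Stage := fun n ↦ step^[n] ⟨(s₀, C₀), h₀⟩
  have hsucc : ∀ n, C (n + 1) = step (C n) := fun n ↦ Function.iterate_succ_apply' _ _ _
  have hC : G.IsLinkedSequence fun n ↦ (C n).1.2 := by
    refine ⟨fun n ↦ ?_, fun n ↦ (C n).2.finite, fun n ↦ ?_, fun n ↦ ?_⟩ <;> rw [hsucc]
    exacts [(hstep _).1, (hstep _).2.1, (hstep _).2.2]
  obtain ⟨R, ⟨N, hN⟩, hR⟩ := hC.exists_not_isEvenEnd (fun n ↦ (C n).2.connected)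
    (fun n ↦ (C n).2.odd) hloop hG
  exact ⟨R, ⟨N, fun n hn ↦ (C 0).2.subset (hN n hn)⟩, hR⟩

lemma edgesBetween_comm (G : Graph α β) (A B : Set α) :
    G.edgesBetween A B = G.edgesBetween B A := by
  ext e
  exact ⟨fun ⟨x, hx, y, hy, h⟩ ↦ ⟨y, hy, x, hx, h.symm⟩,
    fun ⟨x, hx, y, hy, h⟩ ↦ ⟨y, hy, x, hx, h.symm⟩⟩

lemma IsCutWithSides.symm {G : Graph α β} {F : Set β} {A B : Set α}
    (h : G.IsCutWithSides F A B) : G.IsCutWithSides F B A :=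
  ⟨by rw [Set.union_comm, h.1], h.2.1.symm, by rw [edgesBetween_comm, ← h.2.2]⟩

lemma IsCutWithSides.eq_boundary {G : Graph α β} {F : Set β} {A B : Set α}
    (h : G.IsCutWithSides F A B) : F = G.boundary B := by
  obtain ⟨h1, h2, rfl⟩ := h
  ext e
  constructor
  · rintro ⟨x, hx, y, hy, hxy⟩
    exact ⟨y, x, hxy.symm, hy, Set.disjoint_left.1 h2 hx⟩
  · rintro ⟨x, y, hxy, hx, hy⟩
    have : y ∈ A ∪ B := h1 ▸ hxy.right_mem
    exact ⟨y, this.resolve_right hy, x, hx, hxy.symm⟩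

lemma IsInnerEulerian.even_of_livesIn {G : Graph α β} (hloop : G.Loopless)
    (hG : G.IsLocallyFinite) {T : Set G.VertexOrEnd} (hT : G.IsInnerEulerian T)
    {F : Set β} {A B : Set α} (hF : G.IsCutWithSides F A B) (hfin : F.Finite)
    (hlives : G.LivesIn T A) : Even F.ncard := by
  have hinc : ∀ x, (G.incidenceSet x).Finite := by
    intro x
    by_cases hx : x ∈ V(G)
    · exact Set.encard_lt_top_iff.1 (hG x hx)
    · refine Set.finite_empty.subset fun e he ↦ hx ?_
      rw [mem_incidenceSet] at he
      exact he.vertex_mem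
  have hdisj := Set.disjoint_left.1 hF.2.1
  by_contra hodd
  rw [Nat.not_even_iff_odd, hF.eq_boundary] at hodd
  rw [hF.eq_boundary] at hfin
  obtain ⟨R, ⟨N, hN⟩, hR⟩ := exists_not_isEvenEnd_of_odd
    (fun e x h ↦ hloop.not_isLoopAt e x h) hinc hfin hodd (fun x hx ↦ by
      have hxV : x ∈ V(G) := hF.1 ▸ Or.inr hx
      obtain ⟨n, hn, hn'⟩ := hT.1 ⟨x, hxV⟩ fun h ↦ hdisj (hlives.1 _ h) hx
      have : (G.incidenceSet x).ncard = n := by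
        rw [Set.ncard, show (G.incidenceSet x).encard = n from hn, ENat.toNat_natCast]
      rwa [this])
  -- If the end were in `T`, the ray would have tails in both `A` and `B`.
  refine hR (hT.2 _ fun h ↦ ?_)
  obtain ⟨M, hM⟩ := hlives.2 R h
  exact hdisj (hM (max M N) (le_max_left _ _)) (hN (max M N) (le_max_right _ _))

end Graph

theorem lemmaA3 {α β : Type*} (G : Graph α β) (hloopless : G.Loopless)
    (hG : G.IsLocallyFinite) (T : Set G.VertexOrEnd) (hT : G.IsInnerEulerian T)
    (F : Set β) (A B : Set α) (hF : G.IsCutWithSides F A B) (hfin : F.Finite)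
    (hlives : G.LivesIn T A ∨ G.LivesIn T B) :
    Even F.ncard := by
  rcases hlives with h | h
  · exact hT.even_of_livesIn hloopless hG hF hfin h
  · exact hT.even_of_livesIn hloopless hG hF.symm hfin h
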